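/- Let $d\ge1$, $J\in\mathbb R$, $s\in(d,d+1]$ and $\beta\in(0,\infty)$. Consider the Ising model on $\mathbb Z^d$, with spins $\sigma_i\in\{+1,-1\}$, given by the formal Hamiltonian $$H(\sigma)=-\sum_{\langle i,j\rangle}J\sigma_i\sigma_j+\frac12\sum_{i,j}K_{i,j}\sigma_i\sigma_j,\qquad K_{i,j}=\frac1{|i-j|^{s}}\ (i\ne j),\quad K_{i,i}=0,$$ where $\langle i,j\rangle$ runs over the nearest-neighbor pairs (each counted once) and $|i-j|$ is the Euclidean distance. For finite $\Lambda\subset\mathbb Z^d$ let $H_\Lambda$ be obtained from $H$ by discarding all terms with both $i$ and $j$ outside $\Lambda$. For $h\in\mathbb R$ and a boundary condition $\eta\in\{+1,-1\}^{\mathbb Z^d}$ let $$Z_{\Lambda,h}(\eta)=\sum_{\sigma}\exp\Bigl\{-\beta\Bigl[H_\Lambda(\sigma)-h\sum_{i\in\Lambda}\sigma_i\Bigr]\Bigr\},$$ where the sum is over all $\sigma\in\{+1,-1\}^{\mathbb Z^d}$ that agree with $\eta$ outside $\Lambda$. Let $\Lambda_L=[-L,L]^d\cap\mathbb Z^d$.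 Then the limit $$f(\beta,h)=-\frac1\beta\lim_{L\to\infty}\frac1{|\Lambda_L|}\log Z_{\Lambda_L,h}(\eta)$$ exists for every $h\in\mathbb R$ and every $\eta$ and does not depend on $\eta$, the right derivative of $h\mapsto f(\beta,h)$ at $h=0$ exists, and the spontaneous magnetization $$m_\star=-\frac{\partial f}{\partial h^+}\Big|_{h=0}$$ is zero. -/

import Mathlib

open Filter Topology

noncomputable section

namespace LongRangeIsing

/-- The sites of the lattice `ℤ^d`. -/
abbrev Site (d : ℕ) : Type := Fin d → ℤ

/-- Spin configurations `σ ∈ {+1, -1}^(ℤ^d)`; the units of `ℤ` are exactly `1` and `-1`. -/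
abbrev Config (d : ℕ) : Type := Site d → ℤˣ

/-- The spin at the site `i`, as a real number. -/
def spin {d : ℕ} (σ : Config d) (i : Site d) : ℝ := ((σ i : ℤ) : ℝ)

/-- Euclidean distance of two sites. -/
def eucDist {d : ℕ} (i j : Site d) : ℝ := Real.sqrt (∑ k, ((i k : ℝ) - (j k : ℝ)) ^ 2)

/-- The long-range coupling `K_{ij} = |i - j|^(-s)` for `i ≠ j`, with `K_{ii} = 0`. -/
def longRange {d : ℕ} (s : ℝ) (i j : Site d) : ℝ :=
  if i = j then 0 else 1 / eucDist i j ^ s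

/-- The indicator that `i` and `j` are nearest neighbours in `ℤ^d`. -/
def nearest {d : ℕ} (i j : Site d) : ℝ :=
  if ∑ k, |i k - j k| = 1 then 1 else 0

/-- For a symmetric coupling `C` that vanishes on the diagonal, the sum of `C_{ij} σ_i σ_j` over
all unordered pairs `{i, j}` that are not contained in the complement of `Λ`: pairs inside `Λ`
(each one appears twice in the double sum), then pairs with exactly one site in `Λ`. -/
def pairSum {d : ℕ} (C : Site d → Site d → ℝ) (Λ : Finset (Site d)) (σ : Config d) : ℝ :=
  (1 / 2) * ∑ i ∈ Λ, ∑ j ∈ Λ, C i j * spin σ i * spin σ j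
    + ∑ i ∈ Λ, ∑' j : {j : Site d // j ∉ Λ}, C i j * spin σ i * spin σ j

/-- The Hamiltonian `H_Λ(σ)`: the terms of
`-∑_{⟨i,j⟩} J σ_i σ_j + ½ ∑_{i,j} K_{ij} σ_i σ_j` that have at least one site in `Λ`. -/
def hamiltonian {d : ℕ} (J s : ℝ) (Λ : Finset (Site d)) (σ : Config d) : ℝ :=
  -J * pairSum nearest Λ σ + pairSum (longRange s) Λ σ

/-- The configuration that equals `τ` in `Λ` and `η` outside `Λ`. -/
def glue {d : ℕ} (Λ : Finset (Site d)) (τ : Λ → ℤˣ) (η : Config d) : Config d :=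
  fun i => if hi : i ∈ Λ then τ ⟨i, hi⟩ else η i

/-- The partition function `Z_{Λ,h}(η)` at inverse temperature `β`, in the homogeneous external
field `h`, with boundary condition `η` outside `Λ`. -/
def partitionFunction {d : ℕ} (J s β h : ℝ) (Λ : Finset (Site d)) (η : Config d) : ℝ :=
  ∑ τ : Λ → ℤˣ, Real.exp
    (-β * (hamiltonian J s Λ (glue Λ τ η) - h * ∑ i ∈ Λ, spin (glue Λ τ η) i))

/-- The box `Λ_L = [-L, L]^d ∩ ℤ^d`. -/
def box (d L : ℕ) : Finset (Site d) := Fintype.piFinset fun _ => Finset.Icc (-(L : ℤ)) (L : ℤ)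

/-- The free energy per site in the box `Λ_L` with boundary condition `η`. -/
def boxFreeEnergy {d : ℕ} (J s β h : ℝ) (η : Config d) (L : ℕ) : ℝ :=
  -(1 / β) * (1 / ((box d L).card : ℝ) * Real.log (partitionFunction J s β h (box d L) η))

/-- The infinite-volume free energy `f(β, h)`, as the limit over the boxes `Λ_L` with the plus
boundary condition. -/
def freeEnergy (d : ℕ) (J s β h : ℝ) : ℝ :=
  limUnder atTop (boxFreeEnergy J s β h (fun _ : Site d => (1 : ℤˣ)))

/-- The spontaneous magnetization: minus the right derivative of `h ↦ f(β, h)` at `h = 0`. -/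
def spontaneousMagnetization (d : ℕ) (J s β : ℝ) : ℝ :=
  -derivWithin (fun h => freeEnergy d J s β h) (Set.Ici 0) 0

end LongRangeIsing

end

open LongRangeIsing

set_option linter.unusedSectionVars false

noncomputable section

namespace LongRangeIsing

/-! ### Finite Ising systems: Gibbs averages, flip inequality, tile products -/

section FiniteIsing

/-! The antiferromagnetic tail makes uniform magnetization too expensive. By Jensen's inequality,
flipping all spins in a set `S` cannot lower the mean energy of a Gibbs state (`gibbs_cut_le`),
which bounds the correlations between `S` and its complement by the field energy of `S`. Take for
`S` a slab of thickness `L` orthogonal to a coordinate axis and sum over all positions of the slab.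
A pair with displacement `y` along the axis is cut, in a given order, by `min L |y|` slabs, so the
sum of `K_{pq} min(L, |y|) ⟨σ_p σ_q⟩` over the ordered pairs of a volume of `V` sites is at most `(h
L + const) V`, the constant coming from the nearest-neighbour term (`sum_cutKernel_gibbs_le`).

Suppose now that the right derivative of the pressure at zero field is `β m` with `m > 0`. Then the
correlations should average to about `m ^ 2`, and the same sum is at least a fixed fraction of `m ^
2 G_L V`, up to errors of order `V`, where `G_L` is the sum of `|y|^(-s) min(L, |y_0|)` over the
lattice. Since `s ≤ d + 1`, `G_L` diverges with `L` (`exists_le_tsum_cutKernel`). Taking `L` large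
and then `h ≤ 1 / L` gives a contradiction (`not_magnetized`).

To justify `m ^ 2`, the volume is cut into tiles of side `2 R + 1`. Tile magnetizations concentrate
at `m`: an exponential Chebyshev bound, in which the tiles decouple up to boundary terms, controls
the upper deviations (`sum_gibbs_posPart_le`), and convexity of the pressure bounds the mean from
below (`exists_tile_concentration`). The weighted kernel is nearly constant on pairs of tiles, with
an error uniform in `L` (`abs_cutKernel_add_sub_le`). The order of choices is essential: `R` and a
bound on `h` first, then `L`, then `h`, then the volume.

Existence of the free energy and its independence of the boundary condition rest on summability of
the coupling (`s > d`), which makes all interactions across the boundary of a large box negligible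
compared with its volume. -/

/-- A unit of `ℤ` as a real number. -/
def sgn (u : ℤˣ) : ℝ := ((u : ℤ) : ℝ)

lemma sgn_neg (u : ℤˣ) : sgn (-u) = -sgn u := by simp [sgn]

lemma sgn_eq_or (u : ℤˣ) : sgn u = 1 ∨ sgn u = -1 := by
  rcases Int.units_eq_one_or u with h | h <;> simp [sgn, h]

lemma abs_sgn (u : ℤˣ) : |sgn u| = 1 := by
  rcases sgn_eq_or u with h | h <;> simp [h]

/-- The logarithm of a sum of exponentials is Lipschitz with respect to the sup distance. -/
lemma abs_log_sum_exp_sub_le {α : Type*} [Fintype α] [Nonempty α] (f g : α → ℝ) (D : ℝ)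
    (hD : ∀ a, |f a - g a| ≤ D) :
    |Real.log (∑ a, Real.exp (f a)) - Real.log (∑ a, Real.exp (g a))| ≤ D := by
  have key : ∀ f g : α → ℝ, (∀ a, |f a - g a| ≤ D) →
      Real.log (∑ a, Real.exp (f a)) - Real.log (∑ a, Real.exp (g a)) ≤ D := by
    intro f g hD
    have hg : 0 < ∑ a, Real.exp (g a) :=
      Finset.sum_pos (fun a _ => Real.exp_pos _) Finset.univ_nonempty
    have hf : 0 < ∑ a, Real.exp (f a) :=
      Finset.sum_pos (fun a _ => Real.exp_pos _) Finset.univ_nonempty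
    have h : ∑ a, Real.exp (f a) ≤ Real.exp D * ∑ a, Real.exp (g a) := by
      rw [Finset.mul_sum]
      refine Finset.sum_le_sum fun a _ => ?_
      rw [← Real.exp_add]
      exact Real.exp_le_exp.2 (by linarith [le_abs_self (f a - g a), hD a])
    have := Real.log_le_log hf h
    rw [Real.log_mul (Real.exp_ne_zero _) hg.ne', Real.log_exp] at this
    linarith
  rw [abs_le]
  constructor
  · have := key g f fun a => by rw [abs_sub_comm]; exact hD a
    linarith
  · exact key f g hD

variable {ι κ : Type*} [Fintype ι] [Fintype κ]

/-- Energy of a finite Ising system with pair couplings `A` in the homogeneous field `h`. -/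
def energy (A : ι → ι → ℝ) (h : ℝ) (τ : ι → ℤˣ) : ℝ :=
  (1 / 2) * ∑ i, ∑ j, A i j * sgn (τ i) * sgn (τ j) - h * ∑ i, sgn (τ i)

/-- Boltzmann weight of a finite Ising system. -/
def weight (β : ℝ) (A : ι → ι → ℝ) (h : ℝ) (τ : ι → ℤˣ) : ℝ := Real.exp (-β * energy A h τ)

/-- Partition function of a finite Ising system. -/
def finZ [DecidableEq ι] (β : ℝ) (A : ι → ι → ℝ) (h : ℝ) : ℝ := ∑ τ, weight β A h τ

/-- Gibbs expectation in a finite Ising system. -/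
def gibbs [DecidableEq ι] (β : ℝ) (A : ι → ι → ℝ) (h : ℝ) (f : (ι → ℤˣ) → ℝ) : ℝ :=
  (∑ τ, f τ * weight β A h τ) / finZ β A h

lemma weight_pos (β : ℝ) (A : ι → ι → ℝ) (h : ℝ) (τ : ι → ℤˣ) : 0 < weight β A h τ :=
  Real.exp_pos _

lemma abs_energy_sub_le (A B : ι → ι → ℝ) (h : ℝ) (τ : ι → ℤˣ) :
    |energy A h τ - energy B h τ| ≤ (1 / 2) * ∑ i, ∑ j, |A i j - B i j| := by
  have : energy A h τ - energy B h τ =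
      (1 / 2) * ∑ i, ∑ j, (A i j - B i j) * sgn (τ i) * sgn (τ j) := by
    simp only [energy, sub_mul, Finset.sum_sub_distrib]
    ring
  rw [this, abs_mul, abs_of_pos (by norm_num : (0 : ℝ) < 1 / 2)]
  gcongr
  refine (Finset.abs_sum_le_sum_abs _ _).trans (Finset.sum_le_sum fun i _ => ?_)
  refine (Finset.abs_sum_le_sum_abs _ _).trans (Finset.sum_le_sum fun j _ => ?_)
  rw [abs_mul, abs_mul, abs_sgn, abs_sgn, mul_one, mul_one]

lemma abs_sum_sgn_le (τ : ι → ℤˣ) : |∑ i, sgn (τ i)| ≤ Fintype.card ι := by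
  refine (Finset.abs_sum_le_sum_abs _ _).trans ?_
  simp [abs_sgn]

variable [DecidableEq ι] [DecidableEq κ]

lemma finZ_pos (β : ℝ) (A : ι → ι → ℝ) (h : ℝ) : 0 < finZ β A h :=
  Finset.sum_pos (fun τ _ => weight_pos β A h τ) Finset.univ_nonempty

lemma gibbs_mono {β : ℝ} {A : ι → ι → ℝ} {h : ℝ} {f g : (ι → ℤˣ) → ℝ} (hfg : ∀ τ, f τ ≤ g τ) :
    gibbs β A h f ≤ gibbs β A h g :=
  div_le_div_of_nonneg_right (Finset.sum_le_sum fun τ _ =>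
    mul_le_mul_of_nonneg_right (hfg τ) (weight_pos β A h τ).le) (finZ_pos β A h).le

lemma gibbs_const (β : ℝ) (A : ι → ι → ℝ) (h a : ℝ) : gibbs β A h (fun _ => a) = a := by
  rw [gibbs, ← Finset.mul_sum, ← finZ, mul_div_cancel_right₀ _ (finZ_pos β A h).ne']

lemma gibbs_add (β : ℝ) (A : ι → ι → ℝ) (h : ℝ) (f g : (ι → ℤˣ) → ℝ) :
    gibbs β A h (fun τ => f τ + g τ) = gibbs β A h f + gibbs β A h g := by
  simp only [gibbs, add_mul, Finset.sum_add_distrib, add_div]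

lemma gibbs_const_mul (β : ℝ) (A : ι → ι → ℝ) (h a : ℝ) (f : (ι → ℤˣ) → ℝ) :
    gibbs β A h (fun τ => a * f τ) = a * gibbs β A h f := by
  simp only [gibbs, mul_assoc, ← Finset.mul_sum, mul_div_assoc]

lemma gibbs_sub (β : ℝ) (A : ι → ι → ℝ) (h : ℝ) (f g : (ι → ℤˣ) → ℝ) :
    gibbs β A h (fun τ => f τ - g τ) = gibbs β A h f - gibbs β A h g := by
  simp only [gibbs, sub_mul, Finset.sum_sub_distrib, sub_div]

lemma gibbs_sum (β : ℝ) (A : ι → ι → ℝ) (h : ℝ) {α : Type*} (s : Finset α)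
    (f : α → (ι → ℤˣ) → ℝ) :
    gibbs β A h (fun τ => ∑ a ∈ s, f a τ) = ∑ a ∈ s, gibbs β A h (f a) := by
  simp only [gibbs, Finset.sum_mul, ← Finset.sum_div]
  rw [Finset.sum_comm]

lemma abs_gibbs_le {β : ℝ} {A : ι → ι → ℝ} {h D : ℝ} {f : (ι → ℤˣ) → ℝ}
    (hf : ∀ τ, |f τ| ≤ D) : |gibbs β A h f| ≤ D := by
  rw [abs_le]
  constructor
  · calc -D = gibbs β A h (fun _ => -D) := (gibbs_const ..).symm
      _ ≤ _ := gibbs_mono fun τ => (abs_le.1 (hf τ)).1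
  · calc _ ≤ gibbs β A h (fun _ => D) := gibbs_mono fun τ => (abs_le.1 (hf τ)).2
      _ = D := gibbs_const ..

lemma gibbs_pos {β : ℝ} {A : ι → ι → ℝ} {h : ℝ} {f : (ι → ℤˣ) → ℝ} (hf : ∀ τ, 0 < f τ) :
    0 < gibbs β A h f :=
  div_pos (Finset.sum_pos (fun τ _ => mul_pos (hf τ) (weight_pos β A h τ)) Finset.univ_nonempty)
    (finZ_pos β A h)

/-- Jensen's inequality for the exponential. -/
lemma gibbs_le_log (β : ℝ) (A : ι → ι → ℝ) (h : ℝ) (X : (ι → ℤˣ) → ℝ) :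
    gibbs β A h X ≤ Real.log (gibbs β A h fun τ => Real.exp (X τ)) := by
  set M := gibbs β A h fun τ => Real.exp (X τ) with hM
  have hMpos : 0 < M := gibbs_pos fun τ => Real.exp_pos _
  -- This is the tangent line of `exp` at `log M`, divided by `M` and averaged.
  have h1 : gibbs β A h (fun τ => X τ - (Real.log M - 1)) ≤
      gibbs β A h (fun τ => (1 / M) * Real.exp (X τ)) := by
    refine gibbs_mono fun τ => ?_
    have := Real.add_one_le_exp (X τ - Real.log M)
    rw [Real.exp_sub, Real.exp_log hMpos] at this
    rw [one_div_mul_eq_div]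
    linarith
  rw [gibbs_sub, gibbs_const, gibbs_const_mul, ← hM, one_div_mul_cancel hMpos.ne'] at h1
  linarith

lemma finZ_reindex (β : ℝ) (e : ι ≃ κ) (A : κ → κ → ℝ) (h : ℝ) :
    finZ β (fun i j => A (e i) (e j)) h = finZ β A h := by
  unfold finZ
  refine Fintype.sum_equiv (Equiv.arrowCongr e (Equiv.refl _)) _ _ fun τ => ?_
  have h1 : ∀ F : κ → ℝ, ∑ i, F i = ∑ i, F (e i) := fun F => (e.sum_comp F).symm
  simp only [weight, energy, h1]
  simp [Equiv.arrowCongr]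

lemma abs_log_finZ_sub_le {β : ℝ} (hβ : 0 ≤ β) (A B : ι → ι → ℝ) (h : ℝ) :
    |Real.log (finZ β A h) - Real.log (finZ β B h)| ≤ β * ((1 / 2) * ∑ i, ∑ j, |A i j - B i j|) := by
  refine abs_log_sum_exp_sub_le _ _ _ fun τ => ?_
  rw [← mul_sub, abs_mul, abs_neg, abs_of_nonneg hβ]
  exact mul_le_mul_of_nonneg_left (abs_energy_sub_le A B h τ) hβ

lemma abs_log_finZ_field_sub_le {β : ℝ} (hβ : 0 ≤ β) (A : ι → ι → ℝ) (h h' : ℝ) :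
    |Real.log (finZ β A h) - Real.log (finZ β A h')| ≤ β * |h - h'| * Fintype.card ι := by
  refine abs_log_sum_exp_sub_le _ _ _ fun τ => ?_
  have : -β * energy A h τ - -β * energy A h' τ = β * (h - h') * ∑ i, sgn (τ i) := by
    simp only [energy]
    ring
  rw [this, abs_mul, abs_mul, abs_of_nonneg hβ]
  exact mul_le_mul_of_nonneg_left (abs_sum_sgn_le τ) (by positivity)

lemma finZ_neg_field (β : ℝ) (A : ι → ι → ℝ) (h : ℝ) : finZ β A (-h) = finZ β A h := by
  unfold finZ
  refine Fintype.sum_equiv (Equiv.neg _) _ _ fun τ => ?_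
  simp [weight, energy, sgn_neg]

/-- Supporting line inequality for the logarithm of the partition function. -/
lemma field_mul_gibbs_le (β : ℝ) (A : ι → ι → ℝ) (h h' : ℝ) :
    β * (h' - h) * gibbs β A h (fun τ => ∑ i, sgn (τ i)) ≤
      Real.log (finZ β A h') - Real.log (finZ β A h) := by
  rw [← gibbs_const_mul]
  refine (gibbs_le_log _ _ _ _).trans_eq ?_
  rw [← Real.log_div (finZ_pos _ _ _).ne' (finZ_pos _ _ _).ne', gibbs]
  congr 2
  rw [finZ]
  refine Finset.sum_congr rfl fun τ _ => ?_
  rw [weight, weight, ← Real.exp_add, energy, energy]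
  congr 1
  ring

/-- Flipping the spins in a set `S` does not lower the mean energy. -/
lemma gibbs_cut_le {β : ℝ} (hβ : 0 < β) (A : ι → ι → ℝ) (hA : ∀ i j, A i j = A j i) (h : ℝ)
    (S : Finset ι) :
    ∑ i ∈ S, ∑ j ∈ Sᶜ, A i j * gibbs β A h (fun τ => sgn (τ i) * sgn (τ j)) ≤
      h * ∑ i ∈ S, gibbs β A h (fun τ => sgn (τ i)) := by
  set flip : (ι → ℤˣ) → (ι → ℤˣ) := fun τ i => if i ∈ S then -τ i else τ i with hflip
  have hinv : Function.Involutive flip := by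
    intro τ
    funext i
    by_cases hi : i ∈ S <;> simp [hflip, hi]
  set X : (ι → ℤˣ) → ℝ := fun τ =>
    2 * β * (∑ i ∈ S, ∑ j ∈ Sᶜ, A i j * (sgn (τ i) * sgn (τ j)) - h * ∑ i ∈ S, sgn (τ i)) with hX
  -- `X` is the logarithm of the ratio of the weights after and before the flip. Only the pairs cut
  -- by `S` and the field on `S` change sign.
  have hXe : ∀ τ, X τ = -β * energy A h (flip τ) - -β * energy A h τ := by
    intro τ
    have hfS : ∀ i ∈ S, sgn (flip τ i) = -sgn (τ i) := fun i hi => by simp [hflip, hi, sgn_neg]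
    have hfc : ∀ i ∈ Sᶜ, sgn (flip τ i) = sgn (τ i) := fun i hi => by
      simp [hflip, Finset.mem_compl.1 hi]
    have hsum : ∑ i ∈ Sᶜ, ∑ j ∈ S, A i j * sgn (τ i) * sgn (τ j) =
        ∑ i ∈ S, ∑ j ∈ Sᶜ, A i j * sgn (τ i) * sgn (τ j) := by
      rw [Finset.sum_comm]
      refine Finset.sum_congr rfl fun i _ => Finset.sum_congr rfl fun j _ => ?_
      rw [hA j i]; ring
    have e1 : ∀ ρ : ι → ℤˣ, energy A h ρ =
        (1 / 2) * (∑ i ∈ S, ∑ j ∈ S, A i j * sgn (ρ i) * sgn (ρ j)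
          + ∑ i ∈ S, ∑ j ∈ Sᶜ, A i j * sgn (ρ i) * sgn (ρ j)
          + ∑ i ∈ Sᶜ, ∑ j ∈ S, A i j * sgn (ρ i) * sgn (ρ j)
          + ∑ i ∈ Sᶜ, ∑ j ∈ Sᶜ, A i j * sgn (ρ i) * sgn (ρ j))
        - h * (∑ i ∈ S, sgn (ρ i) + ∑ i ∈ Sᶜ, sgn (ρ i)) := by
      intro ρ
      rw [energy, Finset.sum_add_sum_compl, ← Finset.sum_add_sum_compl S]
      congr 2
      rw [← Finset.sum_add_distrib, add_assoc, ← Finset.sum_add_distrib]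
      congr 1 <;> exact Finset.sum_congr rfl fun i _ => (Finset.sum_add_sum_compl S _).symm
    have c1 : ∑ i ∈ S, ∑ j ∈ S, A i j * sgn (flip τ i) * sgn (flip τ j) =
        ∑ i ∈ S, ∑ j ∈ S, A i j * sgn (τ i) * sgn (τ j) :=
      Finset.sum_congr rfl fun i hi => Finset.sum_congr rfl fun j hj => by
        rw [hfS i hi, hfS j hj]; ring
    have c2 : ∑ i ∈ S, ∑ j ∈ Sᶜ, A i j * sgn (flip τ i) * sgn (flip τ j) =
        -∑ i ∈ S, ∑ j ∈ Sᶜ, A i j * sgn (τ i) * sgn (τ j) := by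
      simp only [← Finset.sum_neg_distrib]
      exact Finset.sum_congr rfl fun i hi => Finset.sum_congr rfl fun j hj => by
        rw [hfS i hi, hfc j hj]; ring
    have c3 : ∑ i ∈ Sᶜ, ∑ j ∈ S, A i j * sgn (flip τ i) * sgn (flip τ j) =
        -∑ i ∈ Sᶜ, ∑ j ∈ S, A i j * sgn (τ i) * sgn (τ j) := by
      simp only [← Finset.sum_neg_distrib]
      exact Finset.sum_congr rfl fun i hi => Finset.sum_congr rfl fun j hj => by
        rw [hfc i hi, hfS j hj]; ring
    have c4 : ∑ i ∈ Sᶜ, ∑ j ∈ Sᶜ, A i j * sgn (flip τ i) * sgn (flip τ j) =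
        ∑ i ∈ Sᶜ, ∑ j ∈ Sᶜ, A i j * sgn (τ i) * sgn (τ j) :=
      Finset.sum_congr rfl fun i hi => Finset.sum_congr rfl fun j hj => by
        rw [hfc i hi, hfc j hj]
    have c5 : ∑ i ∈ S, sgn (flip τ i) = -∑ i ∈ S, sgn (τ i) := by
      rw [← Finset.sum_neg_distrib]
      exact Finset.sum_congr rfl fun i hi => hfS i hi
    have c6 : ∑ i ∈ Sᶜ, sgn (flip τ i) = ∑ i ∈ Sᶜ, sgn (τ i) :=
      Finset.sum_congr rfl fun i hi => hfc i hi
    rw [e1 (flip τ), e1 τ, c1, c2, c3, c4, c5, c6, hsum, hX]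
    simp only [mul_assoc]
    ring
  -- Reweighting by `exp X` replaces the weight of `τ` by that of the flipped configuration, and the
  -- flip permutes the configurations. Jensen then gives a nonpositive mean of `X`.
  have hone : gibbs β A h (fun τ => Real.exp (X τ)) = 1 := by
    rw [gibbs, div_eq_one_iff_eq (finZ_pos _ _ _).ne', finZ]
    refine Fintype.sum_equiv hinv.toPerm _ _ fun τ => ?_
    rw [hXe, weight, weight, ← Real.exp_add]
    congr 1
    simp
  have hle := gibbs_le_log β A h X
  rw [hone, Real.log_one, hX, gibbs_const_mul, gibbs_sub, gibbs_sum, gibbs_const_mul,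
    gibbs_sum] at hle
  simp only [gibbs_sum, gibbs_const_mul] at hle
  have := nonpos_of_mul_nonpos_right hle (by positivity : 0 < 2 * β)
  linarith

/-- Sums of tile-wise products factorize. -/
lemma sum_prod_tiles (φ : (κ → ℤˣ) → ℝ) :
    ∑ τ : ι × κ → ℤˣ, ∏ a, φ (fun u => τ (a, u)) = (∑ ρ, φ ρ) ^ Fintype.card ι := by
  have h1 : ∑ τ : ι × κ → ℤˣ, ∏ a, φ (fun u => τ (a, u)) =
      ∑ F : ι → κ → ℤˣ, ∏ a, φ (F a) :=
    Fintype.sum_equiv (Equiv.curry ι κ ℤˣ) _ _ fun τ => rfl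
  rw [h1]
  have := Finset.prod_univ_sum (fun _ : ι => (Finset.univ : Finset (κ → ℤˣ))) (fun _ ρ => φ ρ)
  rw [Fintype.piFinset_univ] at this
  rw [← this, Finset.prod_const, Finset.card_univ]

/-- The coupling on `ι × κ` that is `B` inside each tile `{a} × κ` and zero between tiles. -/
def tileCoupling (B : κ → κ → ℝ) (p q : ι × κ) : ℝ := if p.1 = q.1 then B p.2 q.2 else 0

lemma energy_tileCoupling (B : κ → κ → ℝ) (h : ℝ) (τ : ι × κ → ℤˣ) :
    energy (tileCoupling B) h τ = ∑ a, energy B h (fun u => τ (a, u)) := by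
  simp only [energy, Finset.sum_sub_distrib, ← Finset.mul_sum, Fintype.sum_prod_type,
    tileCoupling]
  congr 2
  refine Finset.sum_congr rfl fun a _ => Finset.sum_congr rfl fun u _ => ?_
  rw [Finset.sum_eq_single a]
  · simp
  · intro b _ hb
    exact Finset.sum_eq_zero fun v _ => by simp [hb.symm]
  · simp

lemma weight_tileCoupling (β : ℝ) (B : κ → κ → ℝ) (h : ℝ) (τ : ι × κ → ℤˣ) :
    weight β (tileCoupling B) h τ = ∏ a, weight β B h (fun u => τ (a, u)) := by
  simp only [weight, energy_tileCoupling, Finset.mul_sum, Real.exp_sum]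

lemma finZ_tileCoupling (β : ℝ) (B : κ → κ → ℝ) (h : ℝ) :
    finZ β (tileCoupling (ι := ι) B) h = finZ β B h ^ Fintype.card ι := by
  simp only [finZ, weight_tileCoupling]
  exact sum_prod_tiles (weight β B h)

/-- The logarithm of the partition function changes by at most a constant per added site. -/
lemma abs_log_finZ_sum_sub_le {β : ℝ} (hβ : 0 ≤ β) (A : ι ⊕ κ → ι ⊕ κ → ℝ) (h C : ℝ)
    (hC : ∀ v, ∑ q, |A (Sum.inr v) q| ≤ C) (hC' : ∀ v, ∑ q, |A q (Sum.inr v)| ≤ C) :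
    |Real.log (finZ β A h) - Real.log (finZ β (fun i j => A (Sum.inl i) (Sum.inl j)) h)| ≤
      (β * (C + |h|) + Real.log 2) * Fintype.card κ := by
  -- The comparison system leaves the added spins free; they contribute the factor `2 ^ card κ`, the
  -- source of the `log 2` per site.
  have hsplit : ∑ τ : ι ⊕ κ → ℤˣ, Real.exp (-β *
      energy (fun i j => A (Sum.inl i) (Sum.inl j)) h (fun i => τ (Sum.inl i))) =
      finZ β (fun i j => A (Sum.inl i) (Sum.inl j)) h * 2 ^ Fintype.card κ := by
    have h0 : ∑ τ : ι ⊕ κ → ℤˣ, Real.exp (-β *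
        energy (fun i j => A (Sum.inl i) (Sum.inl j)) h (fun i => τ (Sum.inl i))) =
        ∑ x : (ι → ℤˣ) × (κ → ℤˣ), weight β (fun i j => A (Sum.inl i) (Sum.inl j)) h x.1 :=
      Fintype.sum_equiv (Equiv.sumArrowEquivProdArrow ι κ ℤˣ) _ _ fun τ => rfl
    rw [h0, Fintype.sum_prod_type]
    simp [finZ, Finset.mul_sum, mul_comm]
  have h1 := abs_log_sum_exp_sub_le
    (fun τ : ι ⊕ κ → ℤˣ => -β * energy A h τ)
    (fun τ => -β * energy (fun i j => A (Sum.inl i) (Sum.inl j)) h (fun i => τ (Sum.inl i)))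
    (β * (C + |h|) * Fintype.card κ) (by
      intro τ
      rw [← mul_sub, abs_mul, abs_neg, abs_of_nonneg hβ, mul_assoc]
      refine mul_le_mul_of_nonneg_left ?_ hβ
      have e : energy A h τ - energy (fun i j => A (Sum.inl i) (Sum.inl j)) h
            (fun i => τ (Sum.inl i)) =
          (1 / 2) * (∑ v, ∑ i, A (Sum.inl i) (Sum.inr v) * sgn (τ (Sum.inl i)) * sgn (τ (Sum.inr v))
            + ∑ v, ∑ q, A (Sum.inr v) q * sgn (τ (Sum.inr v)) * sgn (τ q))
          - h * ∑ v : κ, sgn (τ (Sum.inr v)) := by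
        simp only [energy, Fintype.sum_sum_type, Finset.sum_add_distrib]
        rw [Finset.sum_comm (f := fun v i =>
          A (Sum.inl i) (Sum.inr v) * sgn (τ (Sum.inl i)) * sgn (τ (Sum.inr v)))]
        ring
      have b1 : |∑ v, ∑ i, A (Sum.inl i) (Sum.inr v) * sgn (τ (Sum.inl i)) * sgn (τ (Sum.inr v))| ≤
          Fintype.card κ * C := by
        refine (Finset.abs_sum_le_sum_abs _ _).trans ?_
        rw [← nsmul_eq_mul, ← Finset.card_univ]
        refine Finset.sum_le_card_nsmul _ _ _ fun v _ => ?_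
        refine (Finset.abs_sum_le_sum_abs _ _).trans (le_trans ?_ (hC' v))
        rw [Fintype.sum_sum_type]
        refine le_add_of_le_of_nonneg (Finset.sum_le_sum fun i _ => ?_)
          (Finset.sum_nonneg fun _ _ => abs_nonneg _)
        rw [abs_mul, abs_mul, abs_sgn, abs_sgn, mul_one, mul_one]
      have b2 : |∑ v, ∑ q, A (Sum.inr v) q * sgn (τ (Sum.inr v)) * sgn (τ q)| ≤
          Fintype.card κ * C := by
        refine (Finset.abs_sum_le_sum_abs _ _).trans ?_
        rw [← nsmul_eq_mul, ← Finset.card_univ]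
        refine Finset.sum_le_card_nsmul _ _ _ fun v _ => ?_
        refine (Finset.abs_sum_le_sum_abs _ _).trans (le_trans ?_ (hC v))
        refine Finset.sum_le_sum fun i _ => ?_
        rw [abs_mul, abs_mul, abs_sgn, abs_sgn, mul_one, mul_one]
      have b3 : |h * ∑ v : κ, sgn (τ (Sum.inr v))| ≤ |h| * Fintype.card κ := by
        rw [abs_mul]
        exact mul_le_mul_of_nonneg_left (abs_sum_sgn_le _) (abs_nonneg h)
      rw [e]
      rw [abs_le] at b1 b2 b3 ⊢
      constructor <;> linarith [b1.1, b1.2, b2.1, b2.2, b3.1, b3.2])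
  rw [hsplit, Real.log_mul (finZ_pos _ _ _).ne' (by positivity), Real.log_pow] at h1
  change |Real.log (finZ β A h) - _| ≤ _ at h1
  have hl : 0 ≤ Real.log 2 := Real.log_nonneg (by norm_num)
  have hk : 0 ≤ (Fintype.card κ : ℝ) * Real.log 2 := by positivity
  rw [abs_le] at h1 ⊢
  constructor <;> linarith [h1.1, h1.2]

end FiniteIsing

/-! ### Boxes, tilings, and the infinite-volume pressure -/

section Lattice

variable {d : ℕ}

lemma mem_box {L : ℕ} {i : Site d} : i ∈ box d L ↔ ∀ k, |i k| ≤ L := by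
  simp [box, Fintype.mem_piFinset, abs_le]

lemma card_box (d L : ℕ) : ((box d L).card : ℝ) = (2 * L + 1) ^ d := by
  have h : ((L : ℤ) + 1 + L).toNat = 2 * L + 1 := by omega
  simp [box, Fintype.card_piFinset, h]

lemma card_box_pos (d L : ℕ) : (0 : ℝ) < (box d L).card := by
  rw [card_box]; positivity

lemma box_subset {L M : ℕ} (h : L ≤ M) : box d L ⊆ box d M := fun i hi =>
  mem_box.2 fun k => (mem_box.1 hi k).trans (by exact_mod_cast h)

lemma exists_subset_box (s : Finset (Site d)) : ∃ M, s ⊆ box d M := by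
  refine ⟨s.sup fun i => Finset.univ.sup fun k => (i k).natAbs, fun i hi => mem_box.2 fun k => ?_⟩
  have h1 : (i k).natAbs ≤ Finset.univ.sup fun k => (i k).natAbs :=
    Finset.le_sup (f := fun k => (i k).natAbs) (Finset.mem_univ k)
  have h2 : (Finset.univ.sup fun k => (i k).natAbs) ≤
      s.sup fun i => Finset.univ.sup fun k => (i k).natAbs :=
    Finset.le_sup (f := fun i : Site d => Finset.univ.sup fun k => (i k).natAbs) hi
  have h3 := h1.trans h2
  rw [Int.abs_eq_natAbs]
  exact_mod_cast h3

lemma tendsto_card_box_ratio (d M : ℕ) :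
    Tendsto (fun R : ℕ => ((box d (R - M)).card : ℝ) / (box d R).card) atTop (𝓝 1) := by
  have h1 : Tendsto (fun R : ℕ => (1 - (2 * M : ℝ) / (2 * R + 1)) ^ d) atTop (𝓝 1) := by
    have h2 : Tendsto (fun R : ℕ => (2 * R + 1 : ℝ)) atTop atTop :=
      tendsto_atTop_add_const_right _ _
        (tendsto_natCast_atTop_atTop.const_mul_atTop (by norm_num))
    have h3 := ((tendsto_const_nhds (x := (2 * M : ℝ))).div_atTop h2).const_sub 1
    simpa using h3.pow d
  refine h1.congr' ?_
  filter_upwards [eventually_ge_atTop M] with R hR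
  rw [card_box, card_box, ← div_pow, Nat.cast_sub hR]
  congr 1
  field_simp
  ring

lemma sum_comp_le_tsum {α : Type*} [Fintype α] {F : Site d → ℝ} (h0 : ∀ y, 0 ≤ F y)
    (hF : Summable F) {f : α → Site d} (hf : Function.Injective f) :
    ∑ a, F (f a) ≤ ∑' y, F y := by
  have := (hF.comp_injective hf).sum_le_tsum Finset.univ (fun a _ => h0 _)
  exact this.trans (tsum_comp_le_tsum_of_inj hF h0 hf)

lemma sum_sub_le_tsum {α : Type*} [Fintype α] {F : Site d → ℝ} (h0 : ∀ y, 0 ≤ F y)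
    (hF : Summable F) {f : α → Site d} (hf : Function.Injective f) (i : Site d) :
    ∑ a, F (i - f a) ≤ ∑' y, F y :=
  sum_comp_le_tsum h0 hF (f := fun a => i - f a) fun _ _ h => hf (sub_right_injective h)

/-- The sum of a kernel over all ordered pairs of sites of `Λ`. -/
def pairTotal (F : Site d → ℝ) (Λ : Finset (Site d)) : ℝ := ∑ i : Λ, ∑ j : Λ, F (i - j)

lemma pairTotal_eq_sum (F : Site d → ℝ) (Λ : Finset (Site d)) :
    pairTotal F Λ = ∑ i ∈ Λ, ∑ j ∈ Λ, F (i - j) := by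
  rw [pairTotal, ← Finset.sum_coe_sort Λ fun i => ∑ j ∈ Λ, F (i - j)]
  exact Finset.sum_congr rfl fun i _ => Finset.sum_coe_sort Λ fun j => F (i - j)

/-- Each row sum is at most the full sum. Conversely, a finite set of displacements carries almost
all of `F`, and every site away from the boundary of the box sees all of it. -/
lemma tendsto_pairTotal_box {F : Site d → ℝ} (h0 : ∀ y, 0 ≤ F y) (hF : Summable F) :
    Tendsto (fun R : ℕ => pairTotal F (box d R) / (box d R).card) atTop (𝓝 (∑' y, F y)) := by
  refine tendsto_order.2 ⟨fun a ha => ?_, fun a ha => Eventually.of_forall fun R => ?_⟩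
  · obtain ⟨s, hs⟩ := ((hF.hasSum.eventually_const_lt ha)).exists
    obtain ⟨M, hM⟩ := exists_subset_box s
    have hlim := (tendsto_card_box_ratio d M).mul_const (∑ y ∈ s, F y)
    rw [one_mul] at hlim
    filter_upwards [hlim.eventually_const_lt hs, eventually_ge_atTop M] with R hR hMR
    refine hR.trans_le ?_
    rw [div_mul_eq_mul_div]
    refine div_le_div_of_nonneg_right ?_ (card_box_pos d R).le
    rw [← nsmul_eq_mul, pairTotal_eq_sum]
    refine le_trans ?_ (Finset.sum_le_sum_of_subset_of_nonneg (box_subset (Nat.sub_le R M))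
      fun i _ _ => Finset.sum_nonneg fun j _ => h0 _)
    refine Finset.card_nsmul_le_sum _ _ _ fun i hi => ?_
    have himg : s.image (fun y => i - y) ⊆ box d R := by
      intro j hj
      obtain ⟨y, hy, rfl⟩ := Finset.mem_image.1 hj
      refine mem_box.2 fun k => ?_
      have h1 := mem_box.1 hi k
      have h2 := mem_box.1 (hM hy) k
      have h3 := abs_sub (i k) (y k)
      rw [Pi.sub_apply]
      push_cast [hMR] at h1
      linarith
    refine le_trans (le_of_eq ?_) (Finset.sum_le_sum_of_subset_of_nonneg himg fun j _ _ => h0 _)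
    rw [Finset.sum_image fun x _ y _ h => sub_right_injective h]
    simp
  · refine lt_of_le_of_lt ?_ ha
    rw [div_le_iff₀ (card_box_pos d R), mul_comm, ← nsmul_eq_mul, pairTotal]
    refine (Finset.sum_le_card_nsmul (Finset.univ : Finset (box d R))
      (fun i => ∑ j : box d R, F (i - j)) _ fun i _ =>
      sum_sub_le_tsum h0 hF Subtype.val_injective (i : Site d)).trans_eq ?_
    simp

/-- Total strength of the kernel between `Λ` and its complement. -/
def boundaryTotal (c : Site d → ℝ) (Λ : Finset (Site d)) : ℝ :=
  Λ.card * ∑' y, |c y| - pairTotal (fun y => |c y|) Λ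

lemma tendsto_boundaryTotal_box {c : Site d → ℝ} (hc : Summable fun y => |c y|) :
    Tendsto (fun R : ℕ => boundaryTotal c (box d R) / (box d R).card) atTop (𝓝 0) := by
  have h := (tendsto_pairTotal_box (fun y => abs_nonneg (c y)) hc).const_sub (∑' y, |c y|)
  rw [sub_self] at h
  refine h.congr fun R => ?_
  rw [boundaryTotal, sub_div, mul_div_cancel_left₀ _ (card_box_pos d R).ne']

/-- The position of the site `u` of the tile `a`, for tiles of side `2 R + 1`. -/
def tilePos (k R : ℕ) (p : box d k × box d R) : Site d :=
  (2 * R + 1 : ℤ) • (p.1 : Site d) + (p.2 : Site d)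

lemma tilePos_mem (k R : ℕ) (p : box d k × box d R) :
    tilePos k R p ∈ box d ((2 * R + 1) * k + R) := by
  refine mem_box.2 fun j => ?_
  have h1 := mem_box.1 p.1.2 j
  have h2 := mem_box.1 p.2.2 j
  simp only [tilePos, Pi.add_apply, Pi.smul_apply, smul_eq_mul]
  refine (abs_add_le _ _).trans ?_
  rw [abs_mul, abs_of_nonneg (by positivity : (0 : ℤ) ≤ 2 * R + 1)]
  push_cast
  gcongr

lemma tilePos_injective (k R : ℕ) : Function.Injective (tilePos (d := d) k R) := by
  rintro ⟨⟨a, ha⟩, ⟨u, hu⟩⟩ ⟨⟨b, hb⟩, ⟨v, hv⟩⟩ h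
  have key : ∀ j, a j = b j ∧ u j = v j := by
    intro j
    have h1 := congrFun h j
    simp only [tilePos, Pi.add_apply, Pi.smul_apply, smul_eq_mul] at h1
    have h2 := abs_le.1 (mem_box.1 hu j)
    have h3 := abs_le.1 (mem_box.1 hv j)
    -- Two positions inside a tile differ by at most `2 R`, less than the tile spacing `2 R + 1`.
    have h4 : a j - b j = 0 := by
      by_contra hne
      have h5 : (2 * R + 1 : ℤ) * (a j - b j) = v j - u j := by linarith
      rcases lt_or_gt_of_ne hne with h6 | h6 <;> nlinarith [h2.1, h2.2, h3.1, h3.2]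
    have h5 : a j = b j := by linarith
    rw [h5] at h1
    exact ⟨h5, by linarith⟩
  have e1 : a = b := funext fun j => (key j).1
  have e2 : u = v := funext fun j => (key j).2
  subst e1 e2
  rfl

/-- The box of half-side `(2 R + 1) k + R` is tiled by translates of the box of half-side `R`. -/
def tileEquiv (d k R : ℕ) : box d k × box d R ≃ box d ((2 * R + 1) * k + R) :=
  Equiv.ofBijective (fun p => ⟨tilePos k R p, tilePos_mem k R p⟩) (by
    rw [Fintype.bijective_iff_injective_and_card]
    refine ⟨fun p q h => tilePos_injective k R (congrArg Subtype.val h), ?_⟩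
    rw [Fintype.card_prod, Fintype.card_coe, Fintype.card_coe, Fintype.card_coe]
    have : (((box d k).card * (box d R).card : ℕ) : ℝ) = (box d ((2 * R + 1) * k + R)).card := by
      push_cast
      rw [card_box, card_box, card_box, ← mul_pow]
      push_cast
      ring
    exact_mod_cast this)

lemma card_tiles (d k R : ℕ) :
    ((box d ((2 * R + 1) * k + R)).card : ℝ) = (box d k).card * (box d R).card := by
  have := Fintype.card_congr (tileEquiv d k R)
  rw [Fintype.card_prod, Fintype.card_coe, Fintype.card_coe, Fintype.card_coe] at this
  exact_mod_cast this.symm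

/-- The translation invariant coupling with kernel `c` at the sites `f`. -/
def coupling {α : Type*} (c : Site d → ℝ) (f : α → Site d) (p q : α) : ℝ := c (f p - f q)

/-- The logarithm of the partition function of `Λ` with free boundary condition. -/
def logZ (β : ℝ) (c : Site d → ℝ) (h : ℝ) (Λ : Finset (Site d)) : ℝ :=
  Real.log (finZ β (coupling c (fun i : Λ => (i : Site d))) h)

lemma logZ_tiles (β : ℝ) (c : Site d → ℝ) (h : ℝ) (k R : ℕ) :
    Real.log (finZ β (coupling c (tilePos k R)) h) =
      logZ β c h (box d ((2 * R + 1) * k + R)) := by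
  rw [logZ, ← finZ_reindex β (tileEquiv d k R)]
  rfl

/-- By translation invariance the two couplings agree within a tile, so only pairs in different
tiles count, and a tile interacts with all others no more strongly than with its whole complement in
the lattice. -/
lemma sum_abs_coupling_sub_tileCoupling_le {c : Site d → ℝ} (hc : Summable fun y => |c y|)
    (k R : ℕ) :
    ∑ p, ∑ q, |coupling c (tilePos k R) p q -
      tileCoupling (coupling c (fun i : box d R => (i : Site d))) p q| ≤
      (box d k).card * boundaryTotal c (box d R) := by
  have hpt : ∀ p q : box d k × box d R, |coupling c (tilePos k R) p q -
      tileCoupling (coupling c (fun i : box d R => (i : Site d))) p q| =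
      |c (tilePos k R p - tilePos k R q)| -
        tileCoupling (coupling (fun y => |c y|) (fun i : box d R => (i : Site d))) p q := by
    intro p q
    by_cases h : p.1 = q.1
    · simp [tileCoupling, coupling, h, tilePos]
    · simp [tileCoupling, coupling, h]
  simp only [hpt, Finset.sum_sub_distrib]
  have h1 : ∑ p, ∑ q : box d k × box d R, |c (tilePos k R p - tilePos k R q)| ≤
      (box d k).card * (box d R).card * ∑' y, |c y| := by
    refine (Finset.sum_le_card_nsmul _ _ _ fun p _ => sum_sub_le_tsum
      (fun y => abs_nonneg (c y)) hc (tilePos_injective k R) (tilePos k R p)).trans_eq ?_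
    simp [Fintype.card_prod]
  have h2 : ∑ p : box d k × box d R, ∑ q : box d k × box d R,
      tileCoupling (coupling (fun y => |c y|) (fun i : box d R => (i : Site d))) p q =
      (box d k).card * pairTotal (fun y => |c y|) (box d R) := by
    simp only [Fintype.sum_prod_type, tileCoupling]
    rw [← nsmul_eq_mul, ← Fintype.card_coe, ← Finset.card_univ, ← Finset.sum_const]
    refine Finset.sum_congr rfl fun a _ => ?_
    rw [pairTotal]
    refine Finset.sum_congr rfl fun u _ => ?_
    rw [Finset.sum_eq_single a]
    · simp [coupling]
    · intro b _ hb
      exact Finset.sum_eq_zero fun v _ => by simp [hb.symm]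
    · simp
  rw [h2, boundaryTotal]
  linarith

lemma abs_logZ_tiles_sub_le {β : ℝ} (hβ : 0 ≤ β) {c : Site d → ℝ} (hc : Summable fun y => |c y|)
    (h : ℝ) (k R : ℕ) :
    |logZ β c h (box d ((2 * R + 1) * k + R)) - (box d k).card * logZ β c h (box d R)| ≤
      β * ((1 / 2) * ((box d k).card * boundaryTotal c (box d R))) := by
  have h1 := abs_log_finZ_sub_le hβ (coupling c (tilePos k R))
    (tileCoupling (coupling c (fun i : box d R => (i : Site d)))) h
  rw [logZ_tiles, finZ_tileCoupling, Real.log_pow, Fintype.card_coe] at h1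
  refine h1.trans ?_
  have := sum_abs_coupling_sub_tileCoupling_le hc k R
  gcongr

lemma abs_logZ_sub_le_of_subset {β : ℝ} (hβ : 0 ≤ β) {c : Site d → ℝ}
    (hc : Summable fun y => |c y|) (h : ℝ) {Λ Λ' : Finset (Site d)} (hΛ : Λ ⊆ Λ') :
    |logZ β c h Λ' - logZ β c h Λ| ≤
      (β * (∑' y, |c y| + |h|) + Real.log 2) * (Λ'.card - Λ.card) := by
  have hdisj : Disjoint Λ (Λ' \ Λ) := Finset.disjoint_sdiff
  have hun : Λ ∪ (Λ' \ Λ) = Λ' := Finset.union_sdiff_of_subset hΛ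
  have hcard : ((Λ' \ Λ).card : ℝ) = Λ'.card - Λ.card := by
    rw [Finset.card_sdiff_of_subset hΛ, Nat.cast_sub (Finset.card_le_card hΛ)]
  obtain ⟨e, he⟩ : ∃ e : Λ ⊕ ↥(Λ' \ Λ) ≃ ↥(Λ ∪ (Λ' \ Λ)),
      ∀ i, (e (Sum.inl i) : Site d) = i :=
    ⟨Equiv.Finset.union Λ (Λ' \ Λ) hdisj, fun i => by rw [Equiv.Finset.union_inl]⟩
  obtain ⟨f, hf⟩ : ∃ f : Λ ⊕ ↥(Λ' \ Λ) → Site d, ∀ p, f p = (e p : Site d) := ⟨_, fun _ => rfl⟩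
  have hinj : Function.Injective f := fun p q h => e.injective (Subtype.ext (by
    rw [← hf, ← hf, h]))
  have hb := abs_log_finZ_sum_sub_le hβ (coupling c f) h (∑' y, |c y|)
    (fun v => sum_sub_le_tsum (fun y => abs_nonneg (c y)) hc hinj _)
    (fun v => sum_comp_le_tsum (F := fun y => |c y|) (fun y => abs_nonneg (c y)) hc
      (f := fun q => f q - f (Sum.inr v)) fun _ _ h => hinj (sub_left_injective h))
  have h1 : finZ β (coupling c f) h =
      finZ β (coupling c (fun i : ↥(Λ ∪ (Λ' \ Λ)) => (i : Site d))) h := by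
    rw [← finZ_reindex β e]
    simp only [coupling, ← hf]
    rfl
  have h2 : (fun i j => coupling c f (Sum.inl i) (Sum.inl j)) =
      coupling c (fun i : Λ => (i : Site d)) := by
    funext i j
    simp only [coupling, hf, he]
  rw [h1, h2, Fintype.card_coe, hcard] at hb
  change |logZ β c h (Λ ∪ (Λ' \ Λ)) - logZ β c h Λ| ≤ _ at hb
  rwa [hun] at hb

lemma logZ_empty (β : ℝ) (c : Site d → ℝ) (h : ℝ) : logZ β c h ∅ = 0 := by
  simp [logZ, finZ, weight, energy]

/-- The finite-volume pressure of the box with free boundary condition. -/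
def boxPressure (β : ℝ) (c : Site d → ℝ) (h : ℝ) (N : ℕ) : ℝ :=
  logZ β c h (box d N) / (box d N).card

lemma abs_boxPressure_tiles_sub_le {β : ℝ} (hβ : 0 ≤ β) {c : Site d → ℝ}
    (hc : Summable fun y => |c y|) (h : ℝ) (k R : ℕ) :
    |boxPressure β c h ((2 * R + 1) * k + R) - boxPressure β c h R| ≤
      β * ((1 / 2) * (boundaryTotal c (box d R) / (box d R).card)) := by
  have hk := card_box_pos d k
  have hR := card_box_pos d R
  have e : boxPressure β c h ((2 * R + 1) * k + R) - boxPressure β c h R =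
      (logZ β c h (box d ((2 * R + 1) * k + R)) - (box d k).card * logZ β c h (box d R)) /
        ((box d k).card * (box d R).card) := by
    rw [boxPressure, boxPressure, card_tiles]
    field_simp
  rw [e, abs_div, abs_of_pos (mul_pos hk hR), div_le_iff₀ (mul_pos hk hR)]
  refine (abs_logZ_tiles_sub_le hβ hc h k R).trans_eq ?_
  field_simp

/-- The factor 2 has two sources: the cost of the added sites, and the change of the normalizing
volume. -/
lemma abs_boxPressure_sub_le {β : ℝ} (hβ : 0 ≤ β) {c : Site d → ℝ}
    (hc : Summable fun y => |c y|) (h : ℝ) {M N : ℕ} (hMN : M ≤ N) :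
    |boxPressure β c h N - boxPressure β c h M| ≤
      2 * (β * (∑' y, |c y| + |h|) + Real.log 2) * (1 - (box d M).card / (box d N).card) := by
  have hM := card_box_pos d M
  have hN := card_box_pos d N
  set C := β * (∑' y, |c y| + |h|) + Real.log 2
  have h1 := abs_logZ_sub_le_of_subset hβ hc h (box_subset (d := d) hMN)
  have h2 := abs_logZ_sub_le_of_subset hβ hc h (Finset.empty_subset (box d M))
  rw [logZ_empty, Finset.card_empty, Nat.cast_zero, sub_zero, sub_zero] at h2
  have hcard : ((box d M).card : ℝ) ≤ (box d N).card := by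
    exact_mod_cast Finset.card_le_card (box_subset (d := d) hMN)
  set m := ((box d M).card : ℝ)
  set n := ((box d N).card : ℝ)
  have e : boxPressure β c h N - boxPressure β c h M =
      (logZ β c h (box d N) - logZ β c h (box d M)) / n
        - logZ β c h (box d M) * ((n - m) / (m * n)) := by
    change logZ β c h (box d N) / n - logZ β c h (box d M) / m = _
    field_simp
    ring
  rw [e]
  refine (abs_sub _ _).trans ?_
  have hnn : 0 ≤ (n - m) / (m * n) := div_nonneg (by linarith) (by positivity)
  rw [abs_div, abs_of_pos hN, abs_mul, abs_of_nonneg hnn]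
  have h3 : |logZ β c h (box d N) - logZ β c h (box d M)| / n ≤ C * (n - m) / n :=
    div_le_div_of_nonneg_right h1 hN.le
  have h4 : |logZ β c h (box d M)| * ((n - m) / (m * n)) ≤ C * m * ((n - m) / (m * n)) :=
    mul_le_mul_of_nonneg_right h2 hnn
  refine (add_le_add h3 h4).trans_eq ?_
  field_simp
  ring

/-- Fix `R` with small boundary interaction per site. A large box is nearly filled by a box tiled
exactly by copies of side `2 R + 1`, so its pressure is close to that of the single tile. -/
lemma cauchySeq_boxPressure {β : ℝ} (hβ : 0 ≤ β) {c : Site d → ℝ}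
    (hc : Summable fun y => |c y|) (h : ℝ) : CauchySeq (boxPressure β c h) := by
  rw [Metric.cauchySeq_iff]
  intro ε hε
  have hb := ((tendsto_boundaryTotal_box hc).const_mul (1 / 2)).const_mul β
  rw [mul_zero, mul_zero] at hb
  obtain ⟨R, hR⟩ := (hb.eventually_lt_const (by linarith : (0 : ℝ) < ε / 4)).exists
  have hr := ((tendsto_card_box_ratio d (2 * R + 1)).const_sub 1).const_mul
    (2 * (β * (∑' y, |c y| + |h|) + Real.log 2))
  rw [sub_self, mul_zero] at hr
  have hev : ∀ᶠ N in atTop, |boxPressure β c h N - boxPressure β c h R| < ε / 2 := by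
    filter_upwards [hr.eventually_lt_const (by linarith : (0 : ℝ) < ε / 4),
      eventually_ge_atTop (2 * R + 1)] with N hN hRN
    -- The half-side `(2 R + 1) k + R` is the largest exactly tileable one not exceeding `N`; it
    -- misses `N` by less than `2 R + 1`.
    set k := (N - R) / (2 * R + 1) with hk
    have hdm := Nat.div_add_mod (N - R) (2 * R + 1)
    have hml := Nat.mod_lt (N - R) (by omega : 2 * R + 1 > 0)
    rw [← hk] at hdm
    have hle : (2 * R + 1) * k + R ≤ N := by omega
    have hge : N - (2 * R + 1) ≤ (2 * R + 1) * k + R := by omega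
    have h1 := abs_boxPressure_sub_le hβ hc h hle
    have h2 := abs_boxPressure_tiles_sub_le hβ hc h k R
    have hcard : ((box d (N - (2 * R + 1))).card : ℝ) ≤ (box d ((2 * R + 1) * k + R)).card := by
      exact_mod_cast Finset.card_le_card (box_subset (d := d) hge)
    have hC : 0 ≤ 2 * (β * (∑' y, |c y| + |h|) + Real.log 2) := by
      have : 0 ≤ ∑' y, |c y| := tsum_nonneg fun y => abs_nonneg _
      have := Real.log_nonneg (by norm_num : (1 : ℝ) ≤ 2)
      positivity
    have h3 : 1 - ((box d ((2 * R + 1) * k + R)).card : ℝ) / (box d N).card ≤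
        1 - ((box d (N - (2 * R + 1))).card : ℝ) / (box d N).card := by
      gcongr
    have h4 := h1.trans (mul_le_mul_of_nonneg_left h3 hC)
    calc _ ≤ |boxPressure β c h N - boxPressure β c h ((2 * R + 1) * k + R)| +
        |boxPressure β c h ((2 * R + 1) * k + R) - boxPressure β c h R| := abs_sub_le _ _ _
      _ < ε / 2 := by linarith
  obtain ⟨N₀, hN₀⟩ := eventually_atTop.1 hev
  refine ⟨N₀, fun m hm n hn => ?_⟩
  have h1 := hN₀ m hm
  have h2 := hN₀ n hn
  rw [Real.dist_eq]
  rw [abs_lt] at h1 h2 ⊢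
  constructor <;> linarith [h1.1, h1.2, h2.1, h2.2]

/-- The infinite-volume pressure. -/
def pressure (β : ℝ) (c : Site d → ℝ) (h : ℝ) : ℝ := limUnder atTop (boxPressure β c h)

lemma tendsto_boxPressure {β : ℝ} (hβ : 0 ≤ β) {c : Site d → ℝ}
    (hc : Summable fun y => |c y|) (h : ℝ) :
    Tendsto (boxPressure β c h) atTop (𝓝 (pressure β c h)) :=
  (cauchySeq_boxPressure hβ hc h).tendsto_limUnder

/-- Average the supporting lines at the intermediate point: their slopes cancel. -/
lemma convexOn_boxPressure (β : ℝ) (c : Site d → ℝ) (N : ℕ) :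
    ConvexOn ℝ Set.univ (fun h => boxPressure β c h N) := by
  refine ⟨convex_univ, fun x _ y _ a b ha hb hab => ?_⟩
  simp only [smul_eq_mul, boxPressure]
  rw [← mul_div_assoc, ← mul_div_assoc, ← add_div]
  refine div_le_div_of_nonneg_right ?_ (card_box_pos d N).le
  set A := coupling c (fun i : box d N => (i : Site d))
  have h1 := field_mul_gibbs_le β A (a * x + b * y) x
  have h2 := field_mul_gibbs_le β A (a * x + b * y) y
  set G := gibbs β A (a * x + b * y) (fun τ => ∑ i, sgn (τ i))
  change Real.log (finZ β A _) ≤ a * Real.log (finZ β A x) + b * Real.log (finZ β A y)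
  have h3 := mul_le_mul_of_nonneg_left h1 ha
  have h4 := mul_le_mul_of_nonneg_left h2 hb
  have hb' : b = 1 - a := by linarith
  have e : a * (β * (x - (a * x + b * y)) * G) + b * (β * (y - (a * x + b * y)) * G) = 0 := by
    rw [hb']; ring
  have e2 : a * Real.log (finZ β A (a * x + b * y)) + b * Real.log (finZ β A (a * x + b * y)) =
      Real.log (finZ β A (a * x + b * y)) := by rw [← add_mul, hab, one_mul]
  linarith

lemma convexOn_pressure {β : ℝ} (hβ : 0 ≤ β) {c : Site d → ℝ} (hc : Summable fun y => |c y|) :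
    ConvexOn ℝ Set.univ (pressure β c) := by
  refine ⟨convex_univ, fun x _ y _ a b ha hb hab => ?_⟩
  exact le_of_tendsto_of_tendsto' (tendsto_boxPressure hβ hc _)
    (((tendsto_boxPressure hβ hc x).const_smul a).add ((tendsto_boxPressure hβ hc y).const_smul b))
    fun N => (convexOn_boxPressure β c N).2 (Set.mem_univ x) (Set.mem_univ y) ha hb hab

lemma pressure_neg {β : ℝ} (c : Site d → ℝ) (h : ℝ) : pressure β c (-h) = pressure β c h := by
  have : boxPressure β c (-h) = boxPressure β c h := by
    funext N
    rw [boxPressure, boxPressure, logZ, logZ, finZ_neg_field]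
  rw [pressure, pressure, this]

lemma abs_boxPressure_field_sub_le {β : ℝ} (hβ : 0 ≤ β) (c : Site d → ℝ) (h h' : ℝ) (N : ℕ) :
    |boxPressure β c h N - boxPressure β c h' N| ≤ β * |h - h'| := by
  rw [boxPressure, boxPressure, ← sub_div, abs_div, abs_of_pos (card_box_pos d N),
    div_le_iff₀ (card_box_pos d N)]
  have := abs_log_finZ_field_sub_le hβ (coupling c (fun i : box d N => (i : Site d))) h h'
  rwa [Fintype.card_coe] at this

lemma abs_pressure_sub_le {β : ℝ} (hβ : 0 ≤ β) {c : Site d → ℝ} (hc : Summable fun y => |c y|)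
    (h h' : ℝ) : |pressure β c h - pressure β c h'| ≤ β * |h - h'| :=
  le_of_tendsto' ((tendsto_boxPressure hβ hc h).sub (tendsto_boxPressure hβ hc h')).abs
    fun N => abs_boxPressure_field_sub_le hβ c h h' N

end Lattice

/-! ### Long-range and nearest-neighbour kernels, and the displacement-weighted kernel -/

section Kernels

variable {d : ℕ}

/-- The Euclidean norm of a site. -/
def eucNorm (y : Site d) : ℝ := ‖(WithLp.toLp 2 fun k => (y k : ℝ) : EuclideanSpace ℝ (Fin d))‖

lemma eucDist_eq_eucNorm (i j : Site d) : eucDist i j = eucNorm (i - j) := by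
  simp [eucDist, eucNorm, EuclideanSpace.norm_eq]

lemma eucNorm_zero : eucNorm (0 : Site d) = 0 := by
  have : (WithLp.toLp 2 fun k => ((0 : Site d) k : ℝ) : EuclideanSpace ℝ (Fin d)) = 0 := by
    ext k; simp
  rw [eucNorm, this, norm_zero]

lemma eucNorm_neg (y : Site d) : eucNorm (-y) = eucNorm y := by
  simp [eucNorm, EuclideanSpace.norm_eq]

lemma eucNorm_add_le (y z : Site d) : eucNorm (y + z) ≤ eucNorm y + eucNorm z := by
  refine le_trans (le_of_eq ?_) (norm_add_le _ _)
  rw [eucNorm]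
  congr 1
  ext k
  simp

lemma eucNorm_nonneg (y : Site d) : 0 ≤ eucNorm y := norm_nonneg _

lemma abs_eucNorm_add_sub_le (y z : Site d) : |eucNorm (y + z) - eucNorm y| ≤ eucNorm z := by
  rw [abs_le]
  have h1 := eucNorm_add_le y z
  have h2 := eucNorm_add_le (y + z) (-z)
  rw [add_neg_cancel_right, eucNorm_neg] at h2
  constructor <;> linarith

lemma abs_apply_le_eucNorm (y : Site d) (k : Fin d) : |(y k : ℝ)| ≤ eucNorm y := by
  have := PiLp.norm_apply_le (WithLp.toLp 2 fun k => (y k : ℝ) : EuclideanSpace ℝ (Fin d)) k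
  simpa [eucNorm] using this

lemma one_le_eucNorm {y : Site d} (hy : y ≠ 0) : 1 ≤ eucNorm y := by
  obtain ⟨k, hk⟩ := Function.ne_iff.1 hy
  refine le_trans ?_ (abs_apply_le_eucNorm y k)
  have : (1 : ℤ) ≤ |y k| := Int.one_le_abs hk
  exact_mod_cast this

lemma eucNorm_le_of_abs_le {y : Site d} {n : ℝ} (hn : 0 ≤ n) (h : ∀ k, |(y k : ℝ)| ≤ n) :
    eucNorm y ≤ Real.sqrt d * n := by
  rw [eucNorm, EuclideanSpace.norm_eq, Real.sqrt_le_left (by positivity), mul_pow,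
    Real.sq_sqrt (Nat.cast_nonneg d)]
  refine (Finset.sum_le_card_nsmul _ _ (n ^ 2) fun k _ => ?_).trans_eq (by simp)
  simpa using pow_le_pow_left₀ (abs_nonneg _) (h k) 2

/-- The long-range kernel `|y|^(-s)`. -/
def powKernel (s : ℝ) (y : Site d) : ℝ := longRange s y 0

/-- The nearest-neighbour kernel. -/
def nearKernel (y : Site d) : ℝ := nearest y 0

lemma longRange_eq (s : ℝ) (i j : Site d) : longRange s i j = powKernel s (i - j) := by
  simp [powKernel, longRange, eucDist_eq_eucNorm, sub_eq_zero]

lemma nearest_eq (i j : Site d) : nearest i j = nearKernel (i - j) := by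
  simp [nearKernel, nearest]

lemma powKernel_zero (s : ℝ) : powKernel s (0 : Site d) = 0 := by simp [powKernel, longRange]

lemma powKernel_of_ne (s : ℝ) {y : Site d} (hy : y ≠ 0) : powKernel s y = 1 / eucNorm y ^ s := by
  simp [powKernel, longRange, hy, eucDist_eq_eucNorm]

lemma powKernel_nonneg (s : ℝ) (y : Site d) : 0 ≤ powKernel s y := by
  by_cases hy : y = 0
  · rw [hy, powKernel_zero]
  · rw [powKernel_of_ne s hy]
    have := eucNorm_nonneg y
    positivity

lemma powKernel_neg (s : ℝ) (y : Site d) : powKernel s (-y) = powKernel s y := by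
  by_cases hy : y = 0
  · rw [hy, neg_zero]
  · rw [powKernel_of_ne s hy, powKernel_of_ne s (neg_ne_zero.2 hy), eucNorm_neg]

lemma nearKernel_nonneg (y : Site d) : 0 ≤ nearKernel y := by
  unfold nearKernel nearest
  split_ifs <;> norm_num

lemma nearKernel_neg (y : Site d) : nearKernel (-y) = nearKernel y := by
  simp [nearKernel, nearest]

lemma summable_nearKernel : Summable (nearKernel (d := d)) := by
  refine summable_of_ne_finset_zero (s := box d 1) fun y hy => ?_
  rw [nearKernel, nearest, if_neg]
  intro h
  refine hy (mem_box.2 fun k => ?_)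
  have := Finset.single_le_sum (f := fun k => |y k - (0 : Site d) k|) (fun i _ => abs_nonneg _)
    (Finset.mem_univ k)
  rw [h] at this
  simpa using this

lemma abs_apply_le_one_of_nearKernel_ne_zero {y : Site d} (hy : nearKernel y ≠ 0) (k : Fin d) :
    |(y k : ℝ)| ≤ 1 := by
  rw [nearKernel, nearest, ne_eq, ite_eq_right_iff, not_forall] at hy
  obtain ⟨h, -⟩ := hy
  have := Finset.single_le_sum (f := fun k => |y k - (0 : Site d) k|) (fun i _ => abs_nonneg _)
    (Finset.mem_univ k)
  rw [h] at this
  have h2 : |y k| ≤ 1 := by simpa using this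
  exact_mod_cast h2

lemma summable_powKernel {s : ℝ} (hs : (d : ℝ) < s) : Summable (powKernel (d := d) s) := by
  set b := (EuclideanSpace.basisFun (Fin d) ℝ).toBasis
  set L := Submodule.span ℤ (Set.range b)
  -- `L` is the standard lattice in Euclidean space, for which norm power sums converge once the
  -- exponent exceeds the rank.
  have hr : Module.finrank ℤ L = d := by
    rw [Module.finrank_eq_card_basis (b.restrictScalars ℤ), Fintype.card_fin]
  have h1 := ZLattice.summable_norm_rpow L (-s) (by rw [hr]; linarith)
  set e := (b.restrictScalars ℤ).equivFun
  have h2 := h1.comp_injective e.symm.injective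
  refine h2.of_nonneg_of_le (powKernel_nonneg s) fun y => ?_
  have hn : ‖e.symm y‖ = eucNorm y := by
    rw [eucNorm]
    change ‖((e.symm y : L) : EuclideanSpace ℝ (Fin d))‖ = _
    congr 1
    have hc : ((e.symm y : L) : EuclideanSpace ℝ (Fin d)) = ∑ i, y i • b i := by
      rw [Module.Basis.equivFun_symm_apply, Submodule.coe_sum]
      exact Finset.sum_congr rfl fun i _ => by
        rw [Submodule.coe_smul, Module.Basis.restrictScalars_apply]
    rw [hc]
    ext k
    simp [b, Finset.sum_apply, Pi.single_apply]
  by_cases hy : y = 0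
  · rw [hy, powKernel_zero]
    exact Real.rpow_nonneg (norm_nonneg _) _
  · rw [powKernel_of_ne s hy, Function.comp_apply, hn, Real.rpow_neg (eucNorm_nonneg y), one_div]

/-- A discrete derivative bound for `x^(-s)`, from Bernoulli's inequality: a difference gains one
power of `x`. That power pays for the displacement weight in `abs_cutKernel_add_sub_le`. -/
lemma abs_one_div_rpow_sub_mul_le {a b s : ℝ} (ha : 1 ≤ a) (hb : 1 ≤ b) (hs : 1 ≤ s) :
    |1 / b ^ s - 1 / a ^ s| * a ≤ s * |b - a| * (1 / a ^ s + 1 / b ^ s) := by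
  have bern : ∀ x y : ℝ, 1 ≤ x → x ≤ y → (1 / x ^ s - 1 / y ^ s) * y ≤ s * (y - x) * (1 / x ^ s) := by
    intro x y hx hxy
    have hx0 : 0 < x := by linarith
    have hy0 : 0 < y := by linarith
    have h1 := one_add_mul_self_le_rpow_one_add (s := x / y - 1)
      (by have : 0 < x / y := by positivity
          linarith) hs
    rw [add_sub_cancel, Real.div_rpow hx0.le hy0.le] at h1
    have hxs : 0 < x ^ s := by positivity
    have hys : 0 < y ^ s := by positivity
    have e : (1 / x ^ s - 1 / y ^ s) * y = (1 / x ^ s) * ((1 - x ^ s / y ^ s) * y) := by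
      field_simp
    have e2 : s * (y - x) * (1 / x ^ s) = (1 / x ^ s) * (s * (1 - x / y) * y) := by
      field_simp
    rw [e, e2]
    refine mul_le_mul_of_nonneg_left ?_ (by positivity)
    refine mul_le_mul_of_nonneg_right ?_ hy0.le
    linarith
  have ha0 : 0 < a := by linarith
  have hb0 : 0 < b := by linarith
  have pa : 0 < 1 / a ^ s := by positivity
  have pb : 0 < 1 / b ^ s := by positivity
  rcases le_total a b with h | h
  · have h1 := bern a b ha h
    have hmono : 1 / b ^ s ≤ 1 / a ^ s :=
      one_div_le_one_div_of_le (by positivity) (Real.rpow_le_rpow ha0.le h (by linarith))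
    rw [abs_of_nonpos (by linarith), abs_of_nonneg (by linarith)]
    have h2 : -(1 / b ^ s - 1 / a ^ s) * a ≤ (1 / a ^ s - 1 / b ^ s) * b := by
      rw [neg_sub]
      exact mul_le_mul_of_nonneg_left h (by linarith)
    have h3 : 0 ≤ s * (b - a) * (1 / b ^ s) :=
      mul_nonneg (mul_nonneg (by linarith) (by linarith)) pb.le
    linarith
  · have h1 := bern b a hb h
    have hmono : 1 / a ^ s ≤ 1 / b ^ s :=
      one_div_le_one_div_of_le (by positivity) (Real.rpow_le_rpow hb0.le h (by linarith))
    rw [abs_of_nonneg (by linarith), abs_of_nonpos (by linarith)]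
    have h3 : 0 ≤ s * (a - b) * (1 / a ^ s) :=
      mul_nonneg (mul_nonneg (by linarith) (by linarith)) pa.le
    linarith

/-- The displacement in the direction `k`, truncated at `L`. -/
def truncDisp (k : Fin d) (L : ℕ) (y : Site d) : ℝ := min (L : ℝ) |(y k : ℝ)|

lemma truncDisp_nonneg (k : Fin d) (L : ℕ) (y : Site d) : 0 ≤ truncDisp k L y :=
  le_min (Nat.cast_nonneg L) (abs_nonneg _)

/-- The long-range kernel weighted with the truncated displacement. -/
def cutKernel (s : ℝ) (k : Fin d) (L : ℕ) (y : Site d) : ℝ := powKernel s y * truncDisp k L y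

lemma cutKernel_nonneg (s : ℝ) (k : Fin d) (L : ℕ) (y : Site d) : 0 ≤ cutKernel s k L y :=
  mul_nonneg (powKernel_nonneg s y) (truncDisp_nonneg k L y)

lemma summable_cutKernel {s : ℝ} (hs : (d : ℝ) < s) (k : Fin d) (L : ℕ) :
    Summable (cutKernel s k L) :=
  ((summable_powKernel hs).mul_right (L : ℝ)).of_nonneg_of_le (cutKernel_nonneg s k L) fun y =>
    mul_le_mul_of_nonneg_left (min_le_left _ _) (powKernel_nonneg s y)

/-- The weight is 1-Lipschitz and at most `|y|`, while the increment of `|y|^(-s)` gains a factor `1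
/ |y|`. The bound is therefore summable in `y` and free of `L`, although the weighted kernel has no
uniform bound on its sum when `s` is in the range of the theorem. -/
lemma abs_cutKernel_add_sub_le {s : ℝ} (hs : 1 ≤ s) (k : Fin d) (L : ℕ) (y z : Site d) :
    |cutKernel s k L (y + z) - cutKernel s k L y| ≤
      (s + 1) * eucNorm z * (powKernel s y + powKernel s (y + z)) := by
  have hz := eucNorm_nonneg z
  have hKy := powKernel_nonneg s y
  have hKyz := powKernel_nonneg s (y + z)
  have h1 : |truncDisp k L (y + z) - truncDisp k L y| ≤ eucNorm z := by
    refine le_trans ?_ (abs_apply_le_eucNorm z k)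
    refine (abs_min_sub_min_le_max _ _ _ _).trans ?_
    rw [sub_self, abs_zero, max_eq_right (abs_nonneg _)]
    refine (abs_abs_sub_abs_le_abs_sub _ _).trans (le_of_eq ?_)
    congr 1
    simp
  have h2 : truncDisp k L y ≤ eucNorm y := (min_le_right _ _).trans (abs_apply_le_eucNorm y k)
  have h3 : |powKernel s (y + z) - powKernel s y| * eucNorm y ≤
      s * eucNorm z * (powKernel s y + powKernel s (y + z)) := by
    by_cases hy : y = 0
    · rw [hy] at hKy hKyz
      rw [hy, eucNorm_zero, mul_zero]
      exact mul_nonneg (mul_nonneg (by linarith) hz) (add_nonneg hKy hKyz)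
    by_cases hyz : y + z = 0
    · have hzy : eucNorm y = eucNorm z := by
        rw [← eucNorm_neg y, neg_eq_of_add_eq_zero_right hyz]
      rw [hyz, powKernel_zero, zero_sub, abs_neg, abs_of_nonneg hKy, add_zero, hzy,
        mul_comm (powKernel s y)]
      refine mul_le_mul_of_nonneg_right ?_ hKy
      nlinarith
    · have h4 := abs_one_div_rpow_sub_mul_le (one_le_eucNorm hy) (one_le_eucNorm hyz) hs
      rw [← powKernel_of_ne s hy, ← powKernel_of_ne s hyz] at h4
      refine h4.trans ?_
      have := abs_eucNorm_add_sub_le y z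
      gcongr
  have e : cutKernel s k L (y + z) - cutKernel s k L y =
      powKernel s (y + z) * (truncDisp k L (y + z) - truncDisp k L y) +
        (powKernel s (y + z) - powKernel s y) * truncDisp k L y := by
    simp only [cutKernel]; ring
  rw [e]
  refine (abs_add_le _ _).trans ?_
  rw [abs_mul, abs_mul, abs_of_nonneg hKyz, abs_of_nonneg (truncDisp_nonneg k L y)]
  have h5 := mul_le_mul_of_nonneg_left h1 hKyz
  have h6 := mul_le_mul_of_nonneg_left h2 (abs_nonneg (powKernel s (y + z) - powKernel s y))
  have h7 := mul_nonneg hz hKy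
  nlinarith

/-- The layer at height `t` contains `t ^ d` sites of norm at most a constant times `t`, each
contributing at least a constant times `t ^ (1 - s)`. As `s ≤ d + 2` in dimension `d + 1`, the layer
gives at least a constant times `1 / t`, and the harmonic series diverges. -/
lemma exists_le_tsum_cutKernel {s : ℝ} (hs : ((d + 1 : ℕ) : ℝ) < s)
    (hs' : s ≤ ((d + 1 : ℕ) : ℝ) + 1) (B : ℝ) :
    ∃ L : ℕ, B ≤ ∑' y, cutKernel s (0 : Fin (d + 1)) L y := by
  set C := Real.sqrt (d + 1 : ℕ) with hC
  have hCpos : 0 < C := Real.sqrt_pos.2 (by positivity)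
  have hlow : ∀ L : ℕ, (1 / C ^ s) * ∑ n ∈ Finset.range L, 1 / ((n : ℝ) + 1) ≤
      ∑' y, cutKernel s (0 : Fin (d + 1)) L y := by
    intro L
    -- First coordinate `n + 1`, which is at most `L` so that the truncation is inactive; the other
    -- coordinates range over `0, …, n`.
    let f : (Σ n : Fin L, Fin d → Fin (n + 1)) → Site (d + 1) :=
      fun p => Fin.cons ((p.1 : ℤ) + 1) fun k => ((p.2 k : ℕ) : ℤ)
    have hf : Function.Injective f := by
      rintro ⟨n, u⟩ ⟨m, v⟩ h
      have h' := Fin.cons_injective2 h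
      have h1 : n = m := by
        have := h'.1
        ext
        exact_mod_cast add_right_cancel this
      subst h1
      have h2 : u = v := by
        funext k
        have := congrFun h'.2 k
        ext
        exact_mod_cast this
      rw [h2]
    refine le_trans ?_ (sum_comp_le_tsum (cutKernel_nonneg s 0 L) (summable_cutKernel hs 0 L) hf)
    rw [Fintype.sum_sigma, ← Fin.sum_univ_eq_sum_range (fun n => 1 / ((n : ℝ) + 1)), Finset.mul_sum]
    refine Finset.sum_le_sum fun n _ => ?_
    set t : ℝ := (n : ℝ) + 1 with ht
    have ht1 : 1 ≤ t := by rw [ht]; linarith [Nat.cast_nonneg (α := ℝ) (n : ℕ)]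
    have hterm : ∀ u : Fin d → Fin (n + 1),
        t * (1 / (C * t) ^ s) ≤ cutKernel s (0 : Fin (d + 1)) L (f ⟨n, u⟩) := by
      intro u
      have h0 : f ⟨n, u⟩ 0 = (n : ℤ) + 1 := rfl
      have hne : f ⟨n, u⟩ ≠ 0 := by
        intro h
        have := congrFun h 0
        rw [h0] at this
        simp only [Pi.zero_apply] at this
        omega
      have htr : truncDisp (0 : Fin (d + 1)) L (f ⟨n, u⟩) = t := by
        rw [truncDisp, h0]
        push_cast
        rw [← ht, abs_of_pos (by linarith), min_eq_right]
        have := n.2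
        rw [ht]
        exact_mod_cast this
      have hnorm : eucNorm (f ⟨n, u⟩) ≤ C * t := by
        refine eucNorm_le_of_abs_le (by linarith) fun k => ?_
        refine Fin.cases ?_ (fun k => ?_) k
        · rw [h0]
          push_cast
          rw [abs_of_pos (by linarith)]
        · have h1 : f ⟨n, u⟩ k.succ = ((u k : ℕ) : ℤ) := rfl
          rw [h1]
          have h2 : ((u k : ℕ) : ℝ) ≤ t := by
            have := (u k).2.le
            rw [ht]
            exact_mod_cast this
          simpa using h2
      rw [cutKernel, htr, powKernel_of_ne s hne, mul_comm]
      refine mul_le_mul_of_nonneg_right ?_ (by linarith)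
      have h1 := one_le_eucNorm hne
      exact one_div_le_one_div_of_le (by positivity)
        (Real.rpow_le_rpow (by linarith) hnorm (by linarith [Nat.cast_nonneg (α := ℝ) (d + 1)]))
    refine le_trans ?_ (Finset.card_nsmul_le_sum _ _ _ fun u _ => hterm u)
    rw [Finset.card_univ, Fintype.card_fun, Fintype.card_fin, Fintype.card_fin, nsmul_eq_mul]
    push_cast
    rw [← ht, Real.mul_rpow hCpos.le (by linarith)]
    have hts : t ^ s ≤ t ^ (d + 2) := by
      rw [← Real.rpow_natCast]
      refine Real.rpow_le_rpow_of_exponent_le ht1 ?_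
      push_cast at hs' ⊢
      linarith
    have ht0 : 0 < t := by linarith
    have hCs : 0 < C ^ s := by positivity
    have e : t ^ d * (t * (1 / (C ^ s * t ^ s))) = 1 / C ^ s * (t ^ (d + 1) / t ^ s) := by
      field_simp
      rw [pow_succ]
    rw [e]
    refine mul_le_mul_of_nonneg_left ?_ (by positivity)
    rw [div_le_div_iff₀ ht0 (by positivity), one_mul, ← pow_succ]
    exact hts
  have hdiv := Real.tendsto_sum_range_one_div_nat_succ_atTop.const_mul_atTop
    (by positivity : 0 < 1 / C ^ s)
  obtain ⟨L, hL⟩ := (hdiv.eventually_ge_atTop B).exists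
  exact ⟨L, hL.trans (hlow L)⟩

end Kernels

/-! ### Comparison with the free boundary condition -/

section BoundaryCondition

variable {d : ℕ}

/-- The kernel of the Hamiltonian. -/
def fullKernel (J s : ℝ) (y : Site d) : ℝ := powKernel s y - J * nearKernel y

lemma fullKernel_neg (J s : ℝ) (y : Site d) : fullKernel J s (-y) = fullKernel J s y := by
  rw [fullKernel, fullKernel, powKernel_neg, nearKernel_neg]

lemma summable_abs_fullKernel (J : ℝ) {s : ℝ} (hs : (d : ℝ) < s) :
    Summable fun y : Site d => |fullKernel J s y| :=
  ((summable_powKernel hs).sub (summable_nearKernel.mul_left J)).abs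

lemma abs_spin (σ : Config d) (i : Site d) : |spin σ i| = 1 := abs_sgn (σ i)

lemma abs_pairSum_sub_le {C : Site d → Site d → ℝ} {F : Site d → ℝ}
    (hF : Summable fun y => |F y|) (hC : ∀ i j, C i j = F (i - j)) (Λ : Finset (Site d))
    (σ : Config d) :
    |pairSum C Λ σ - (1 / 2) * ∑ i ∈ Λ, ∑ j ∈ Λ, C i j * spin σ i * spin σ j| ≤
      boundaryTotal F Λ := by
  rw [pairSum, add_sub_cancel_left]
  refine (Finset.abs_sum_le_sum_abs _ _).trans ?_
  rw [boundaryTotal, pairTotal_eq_sum, ← nsmul_eq_mul, ← Finset.sum_const,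
    ← Finset.sum_sub_distrib]
  refine Finset.sum_le_sum fun i _ => ?_
  have hs : Summable fun j => |F (i - j)| := (Equiv.subLeft i).summable_iff.2 hF
  have ht : ∑' j, |F (i - j)| = ∑' y, |F y| := (Equiv.subLeft i).tsum_eq fun y => |F y|
  have habs : ∀ j, |C i j * spin σ i * spin σ j| = |F (i - j)| := fun j => by
    rw [abs_mul, abs_mul, abs_spin, abs_spin, mul_one, mul_one, hC]
  have h1 := hs.sum_add_tsum_subtype_compl Λ
  have h2 : |∑' j : {j : Site d // j ∉ Λ}, C i j * spin σ i * spin σ j| ≤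
      ∑' j : {j : Site d // j ∉ Λ}, |F (i - j)| := by
    have hsub : Summable fun j : {j : Site d // j ∉ Λ} => |F (i - j)| :=
      hs.comp_injective Subtype.val_injective
    have := norm_tsum_le_tsum_norm (f := fun j : {j : Site d // j ∉ Λ} =>
      C i j * spin σ i * spin σ j) (by simpa only [Real.norm_eq_abs, habs] using hsub)
    simpa only [Real.norm_eq_abs, habs] using this
  rw [← ht, ← h1]
  linarith

/-- The pairs inside `Λ` give exactly the free-boundary energy, so the two energies differ only by
the pairs joining `Λ` to its complement, bounded uniformly in the spins. -/
lemma abs_log_partitionFunction_sub_le (J : ℝ) {s β : ℝ} (hs : (d : ℝ) < s) (hβ : 0 ≤ β) (h : ℝ)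
    (Λ : Finset (Site d)) (η : Config d) :
    |Real.log (partitionFunction J s β h Λ η) - logZ β (fullKernel J s) h Λ| ≤
      β * (|J| * boundaryTotal nearKernel Λ + boundaryTotal (powKernel s) Λ) := by
  refine abs_log_sum_exp_sub_le _ _ _ fun τ => ?_
  rw [← mul_sub, abs_mul, abs_neg, abs_of_nonneg hβ]
  refine mul_le_mul_of_nonneg_left ?_ hβ
  set σ := glue Λ τ η
  have hσ : ∀ i : Λ, spin σ i = sgn (τ i) := fun i => by simp [σ, spin, glue, sgn]
  have hN := abs_pairSum_sub_le (summable_nearKernel (d := d)).abs nearest_eq Λ σ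
  have hK := abs_pairSum_sub_le (summable_powKernel hs).abs (longRange_eq s) Λ σ
  have e1 : ∑ i ∈ Λ, spin σ i = ∑ i, sgn (τ i) := by
    rw [← Finset.sum_coe_sort]
    exact Finset.sum_congr rfl fun i _ => hσ i
  have e2 : ∀ (C : Site d → Site d → ℝ), ∑ i ∈ Λ, ∑ j ∈ Λ, C i j * spin σ i * spin σ j =
      ∑ i : Λ, ∑ j : Λ, C i j * sgn (τ i) * sgn (τ j) := by
    intro C
    rw [← Finset.sum_coe_sort]
    refine Finset.sum_congr rfl fun i _ => ?_
    rw [← Finset.sum_coe_sort]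
    refine Finset.sum_congr rfl fun j _ => ?_
    rw [hσ, hσ]
  rw [e2] at hN hK
  have e3 : hamiltonian J s Λ σ - h * ∑ i ∈ Λ, spin σ i -
      energy (coupling (fullKernel J s) fun i : Λ => (i : Site d)) h τ =
      -J * (pairSum nearest Λ σ -
        (1 / 2) * ∑ i : Λ, ∑ j : Λ, nearest (i : Site d) j * sgn (τ i) * sgn (τ j)) +
      (pairSum (longRange s) Λ σ -
        (1 / 2) * ∑ i : Λ, ∑ j : Λ, longRange s (i : Site d) j * sgn (τ i) * sgn (τ j)) := by
    have e4 : ∑ i : Λ, ∑ j : Λ, coupling (fullKernel J s) (fun i : Λ => (i : Site d)) i j *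
        sgn (τ i) * sgn (τ j) =
        ∑ i : Λ, ∑ j : Λ, longRange s (i : Site d) j * sgn (τ i) * sgn (τ j) -
        J * ∑ i : Λ, ∑ j : Λ, nearest (i : Site d) j * sgn (τ i) * sgn (τ j) := by
      rw [Finset.mul_sum, ← Finset.sum_sub_distrib]
      refine Finset.sum_congr rfl fun i _ => ?_
      rw [Finset.mul_sum, ← Finset.sum_sub_distrib]
      refine Finset.sum_congr rfl fun j _ => ?_
      rw [coupling, fullKernel, longRange_eq, nearest_eq]
      ring
    rw [hamiltonian, energy, e1, e4]
    ring
  rw [e3]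
  refine (abs_add_le _ _).trans (add_le_add ?_ hK)
  rw [abs_mul, abs_neg]
  exact mul_le_mul_of_nonneg_left hN (abs_nonneg J)

lemma tendsto_boxFreeEnergy (J : ℝ) {s β : ℝ} (hs : (d : ℝ) < s) (hβ : 0 < β) (h : ℝ)
    (η : Config d) :
    Tendsto (boxFreeEnergy J s β h η) atTop
      (𝓝 (-(1 / β) * pressure β (fullKernel J s : Site d → ℝ) h)) := by
  have h1 := tendsto_boxPressure hβ.le (summable_abs_fullKernel (d := d) J hs) h
  have h2 := ((((tendsto_boundaryTotal_box (summable_nearKernel (d := d)).abs).const_mul |J|).add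
    (tendsto_boundaryTotal_box (summable_powKernel hs).abs)).const_mul β)
  rw [mul_zero, add_zero, mul_zero] at h2
  have h3 : Tendsto (fun N : ℕ => Real.log (partitionFunction J s β h (box d N) η) / (box d N).card -
      boxPressure β (fullKernel (d := d) J s) h N) atTop (𝓝 0) := by
    refine squeeze_zero_norm (fun N => ?_) h2
    rw [boxPressure, ← sub_div, Real.norm_eq_abs, abs_div, abs_of_pos (card_box_pos d N),
      div_le_iff₀ (card_box_pos d N)]
    refine (abs_log_partitionFunction_sub_le J hs hβ.le h (box d N) η).trans_eq ?_
    have := (card_box_pos d N).ne'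
    field_simp
  have h4 := (h3.add h1).const_mul (-(1 / β))
  rw [zero_add] at h4
  refine h4.congr fun N => ?_
  rw [boxFreeEnergy, sub_add_cancel, one_div_mul_eq_div]

lemma freeEnergy_eq (J : ℝ) {s β : ℝ} (hs : (d : ℝ) < s) (hβ : 0 < β) (h : ℝ) :
    freeEnergy d J s β h = -(1 / β) * pressure β (fullKernel J s : Site d → ℝ) h :=
  (tendsto_boxFreeEnergy J hs hβ h _).limUnder_eq

end BoundaryCondition

/-! ### Summing the flip inequality over slabs -/

section Slabs

lemma card_Ico_sdiff_Ico (a b : ℤ) (L : ℕ) :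
    ((Finset.Ico (a - L) a \ Finset.Ico (b - L) b).card : ℝ) = min (L : ℝ) |((a - b : ℤ) : ℝ)| := by
  have h : ((Finset.Ico (a - L) a \ Finset.Ico (b - L) b).card : ℤ) = min (L : ℤ) |a - b| := by
    have h1 := Finset.card_sdiff_add_card_inter (Finset.Ico (a - L) a) (Finset.Ico (b - L) b)
    rw [Finset.Ico_inter_Ico, Int.card_Ico, Int.card_Ico] at h1
    have h3 : max (a - L) (b - L) = max a b - L := by omega
    rw [h3] at h1
    rcases abs_cases (a - b) with h2 | h2 <;> omega
  rw [← Int.cast_natCast, h]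
  push_cast
  rfl

variable {d : ℕ} {α : Type*} [Fintype α] [DecidableEq α]

/-- Sum `gibbs_cut_le` over all slabs of thickness `L`. The truncated displacement counts the slabs
containing `p` but not `q`, and each site lies in exactly `L` slabs, which gives the right side. -/
lemma sum_truncDisp_gibbs_le {β h : ℝ} (hβ : 0 < β) (hh : 0 ≤ h) {c : Site d → ℝ}
    (hc : ∀ y, c (-y) = c y) (f : α → Site d) (k : Fin d) (L : ℕ) :
    ∑ p, ∑ q, c (f p - f q) * truncDisp k L (f p - f q) *
      gibbs β (coupling c f) h (fun τ => sgn (τ p) * sgn (τ q)) ≤ h * L * Fintype.card α := by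
  set G : α → α → ℝ := fun p q => gibbs β (coupling c f) h (fun τ => sgn (τ p) * sgn (τ q))
  -- `I p` is the set of `x` for which `p` lies in the slab of sites with `k`-th coordinate in `(x,
  -- x + L]`.
  set I : α → Finset ℤ := fun p => Finset.Ico (f p k - L) (f p k) with hI
  set X : Finset ℤ := Finset.univ.biUnion I
  have hIX : ∀ p, I p ⊆ X := fun p => Finset.subset_biUnion_of_mem I (Finset.mem_univ p)
  have hcut : ∀ x : ℤ, ∑ p, ∑ q, (if x ∈ I p \ I q then c (f p - f q) * G p q else 0) ≤
      h * ∑ p, if x ∈ I p then 1 else 0 := by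
    intro x
    set S : Finset α := Finset.univ.filter fun p => x ∈ I p with hS
    have h1 := gibbs_cut_le hβ (coupling c f) (fun p q => by
      rw [coupling, coupling, ← hc, neg_sub]) h S
    have h2 : ∑ p, ∑ q, (if x ∈ I p \ I q then c (f p - f q) * G p q else 0) =
        ∑ p ∈ S, ∑ q ∈ Sᶜ, coupling c f p q * G p q := by
      rw [hS, Finset.sum_filter, Finset.compl_filter]
      refine Finset.sum_congr rfl fun p _ => ?_
      by_cases hp : x ∈ I p
      · simp only [Finset.mem_sdiff, hp, true_and, if_true, Finset.sum_filter, coupling]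
      · simp [hp]
    rw [h2]
    refine h1.trans (mul_le_mul_of_nonneg_left ?_ hh)
    rw [← Finset.sum_filter]
    refine Finset.sum_le_sum fun p _ => ?_
    exact (le_abs_self _).trans (abs_gibbs_le fun τ => (abs_sgn _).le)
  have hsum := Finset.sum_le_sum fun x (_ : x ∈ X) => hcut x
  have e1 : ∑ x ∈ X, ∑ p, ∑ q, (if x ∈ I p \ I q then c (f p - f q) * G p q else 0) =
      ∑ p, ∑ q, c (f p - f q) * truncDisp k L (f p - f q) * G p q := by
    rw [Finset.sum_comm]
    refine Finset.sum_congr rfl fun p _ => ?_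
    rw [Finset.sum_comm]
    refine Finset.sum_congr rfl fun q _ => ?_
    rw [← Finset.sum_filter, Finset.sum_const, nsmul_eq_mul]
    have : X.filter (fun x => x ∈ I p \ I q) = I p \ I q := by
      ext x
      simp only [Finset.mem_filter, and_iff_right_iff_imp]
      exact fun hx => hIX p (Finset.mem_sdiff.1 hx).1
    rw [this, hI, card_Ico_sdiff_Ico, truncDisp, Pi.sub_apply]
    ring
  have e2 : ∑ x ∈ X, h * ∑ p, (if x ∈ I p then (1 : ℝ) else 0) = h * L * Fintype.card α := by
    rw [← Finset.mul_sum, Finset.sum_comm]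
    have : ∀ p, ∑ x ∈ X, (if x ∈ I p then (1 : ℝ) else 0) = L := by
      intro p
      rw [← Finset.sum_filter, Finset.sum_const, nsmul_eq_mul, mul_one]
      have : X.filter (fun x => x ∈ I p) = I p := by
        ext x
        simp only [Finset.mem_filter, and_iff_right_iff_imp]
        exact fun hx => hIX p hx
      rw [this, hI, Int.card_Ico]
      simp
    simp only [this, Finset.sum_const, nsmul_eq_mul, Finset.card_univ]
    ring
  rw [e1, e2] at hsum
  exact hsum

/-- The nearest-neighbour part is moved to the right. Its displacement is at most 1, so its cost per
site does not grow with `L`, whatever the sign of `J`. -/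
lemma sum_cutKernel_gibbs_le {J s β h : ℝ} (hβ : 0 < β) (hh : 0 ≤ h) {f : α → Site d}
    (hf : Function.Injective f) (k : Fin d) (L : ℕ) :
    ∑ p, ∑ q, cutKernel s k L (f p - f q) *
      gibbs β (coupling (fullKernel J s) f) h (fun τ => sgn (τ p) * sgn (τ q)) ≤
      (h * L + |J| * ∑' y : Site d, nearKernel y) * Fintype.card α := by
  have h1 := sum_truncDisp_gibbs_le hβ hh (fullKernel_neg (d := d) J s) f k L
  set G : α → α → ℝ := fun p q =>
    gibbs β (coupling (fullKernel J s) f) h (fun τ => sgn (τ p) * sgn (τ q)) with hG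
  have hGabs : ∀ p q, |G p q| ≤ 1 := fun p q => abs_gibbs_le fun τ => by
    rw [abs_mul, abs_sgn, abs_sgn, one_mul]
  have h2 : ∀ p q, cutKernel s k L (f p - f q) * G p q ≤
      fullKernel J s (f p - f q) * truncDisp k L (f p - f q) * G p q +
        |J| * nearKernel (f p - f q) := by
    intro p q
    have h3 : J * (nearKernel (f p - f q) * truncDisp k L (f p - f q) * G p q) ≤
        |J| * nearKernel (f p - f q) := by
      refine (le_abs_self _).trans ?_
      rw [abs_mul]
      refine mul_le_mul_of_nonneg_left ?_ (abs_nonneg J)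
      rw [abs_mul, abs_mul, abs_of_nonneg (nearKernel_nonneg _),
        abs_of_nonneg (truncDisp_nonneg _ _ _), mul_assoc]
      by_cases hz : nearKernel (f p - f q) = 0
      · rw [hz, zero_mul]
      · refine mul_le_of_le_one_right (nearKernel_nonneg _) ?_
        exact mul_le_one₀ ((min_le_right _ _).trans
          (abs_apply_le_one_of_nearKernel_ne_zero hz k)) (abs_nonneg _) (hGabs p q)
    rw [cutKernel, fullKernel]
    linarith
  have h4 : ∑ p, ∑ q, |J| * nearKernel (f p - f q) ≤
      |J| * (∑' y : Site d, nearKernel y) * Fintype.card α := by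
    simp only [← Finset.mul_sum]
    rw [mul_assoc]
    refine mul_le_mul_of_nonneg_left ?_ (abs_nonneg J)
    refine (Finset.sum_le_card_nsmul _ _ _ fun p _ => sum_sub_le_tsum nearKernel_nonneg
      summable_nearKernel hf (f p)).trans_eq ?_
    rw [nsmul_eq_mul, Finset.card_univ, mul_comm]
  calc _ ≤ ∑ p, ∑ q, (fullKernel J s (f p - f q) * truncDisp k L (f p - f q) * G p q +
        |J| * nearKernel (f p - f q)) :=
        Finset.sum_le_sum fun p _ => Finset.sum_le_sum fun q _ => h2 p q
    _ ≤ _ := by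
      simp only [Finset.sum_add_distrib]
      linarith

end Slabs

/-! ### Upper deviations of tile magnetizations and quadratic forms -/

section Concentration

variable {ι κ : Type*} [Fintype ι] [Fintype κ]

/-- The total spin in the tile `a`. -/
def tileSpin (τ : ι × κ → ℤˣ) (a : ι) : ℝ := ∑ u, sgn (τ (a, u))

lemma sum_tileSpin (τ : ι × κ → ℤˣ) : ∑ a, tileSpin τ a = ∑ p, sgn (τ p) := by
  rw [Fintype.sum_prod_type]; rfl

variable [DecidableEq ι] [DecidableEq κ]

/-- Exponential Chebyshev bound for the positive part of the tile magnetizations. -/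
lemma sum_gibbs_posPart_le {β h t m θ D : ℝ} (hβ : 0 < β) (hθ : 0 ≤ θ)
    (A : ι × κ → ι × κ → ℝ) (B : κ → κ → ℝ) (hD : ∑ p, ∑ q, |A p q - tileCoupling B p q| ≤ D)
    (hB : Real.log (finZ β B (h + t)) ≤
      Real.log (finZ β B h) + β * t * m * Fintype.card κ + θ) :
    β * t * ∑ a, gibbs β A h (fun τ => max (tileSpin τ a - m * Fintype.card κ) 0) ≤
      β * D + Fintype.card ι * (Real.log 2 + θ) := by
  set n : ℝ := (Fintype.card κ : ℝ)
  set φ : (κ → ℤˣ) → ℝ := fun ρ => β * t * max (∑ u, sgn (ρ u) - m * n) 0 with hφ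
  set X : (ι × κ → ℤˣ) → ℝ := fun τ => ∑ a, β * t * max (tileSpin τ a - m * n) 0 with hX
  have hj := gibbs_le_log β A h X
  have hlhs : gibbs β A h X =
      β * t * ∑ a, gibbs β A h (fun τ => max (tileSpin τ a - m * n) 0) := by
    rw [hX, gibbs_sum, Finset.mul_sum]
    exact Finset.sum_congr rfl fun a _ => gibbs_const_mul _ _ _ _ _
  rw [hlhs] at hj
  refine hj.trans ?_
  -- Decoupling the tiles costs `β D / 2` in the numerator and again in the denominator, hence `β D`
  -- in total.
  have hbd : ∀ τ, |-β * energy A h τ - -β * energy (tileCoupling B) h τ| ≤ β * (D / 2) := by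
    intro τ
    rw [← mul_sub, abs_mul, abs_neg, abs_of_pos hβ]
    refine mul_le_mul_of_nonneg_left ((abs_energy_sub_le _ _ _ _).trans ?_) hβ.le
    linarith
  have hnum := (abs_le.1 (abs_log_sum_exp_sub_le (fun τ => X τ + -β * energy A h τ)
    (fun τ => X τ + -β * energy (tileCoupling B) h τ) (β * (D / 2)) fun τ => by
      rw [add_sub_add_left_eq_sub]; exact hbd τ)).2
  have hden := (abs_le.1 (abs_log_sum_exp_sub_le (fun τ => -β * energy A h τ)
    (fun τ => -β * energy (tileCoupling B) h τ) (β * (D / 2)) hbd)).1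
  change _ ≤ Real.log (finZ β A h) - Real.log (finZ β (tileCoupling B) h) at hden
  have hS : 0 < ∑ ρ, Real.exp (φ ρ) * weight β B h ρ :=
    Finset.sum_pos (fun ρ _ => mul_pos (Real.exp_pos _) (weight_pos _ _ _ _)) Finset.univ_nonempty
  have hfac : ∑ τ : ι × κ → ℤˣ, Real.exp (X τ + -β * energy (tileCoupling B) h τ) =
      (∑ ρ, Real.exp (φ ρ) * weight β B h ρ) ^ Fintype.card ι := by
    rw [← sum_prod_tiles]
    refine Finset.sum_congr rfl fun τ _ => ?_
    rw [Real.exp_add, Finset.prod_mul_distrib, ← weight_tileCoupling, ← Real.exp_sum]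
    rfl
  rw [hfac, Real.log_pow] at hnum
  rw [finZ_tileCoupling, Real.log_pow] at hden
  have hratio : Real.log (gibbs β A h fun τ => Real.exp (X τ)) =
      Real.log (∑ τ, Real.exp (X τ + -β * energy A h τ)) - Real.log (finZ β A h) := by
    rw [gibbs, Real.log_div (Finset.sum_pos (fun τ _ => mul_pos (Real.exp_pos _)
      (weight_pos _ _ _ _)) Finset.univ_nonempty).ne' (finZ_pos _ _ _).ne']
    simp only [Real.exp_add, weight]
  have htile : Real.log (∑ ρ, Real.exp (φ ρ) * weight β B h ρ) ≤
      Real.log (finZ β B h) + Real.log 2 + θ := by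
    -- Here `exp (max x 0) ≤ 1 + exp x`, and the second term is a tilt that raises the field from
    -- `h` to `h + t`.
    have h1 : ∑ ρ, Real.exp (φ ρ) * weight β B h ρ ≤
        finZ β B h + Real.exp (-(β * t * m * n)) * finZ β B (h + t) := by
      rw [finZ, finZ, Finset.mul_sum, ← Finset.sum_add_distrib]
      refine Finset.sum_le_sum fun ρ _ => ?_
      have h2 : Real.exp (-(β * t * m * n)) * weight β B (h + t) ρ =
          Real.exp (β * t * (∑ u, sgn (ρ u) - m * n)) * weight β B h ρ := by
        rw [weight, weight, ← Real.exp_add, ← Real.exp_add, energy, energy]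
        congr 1
        ring
      rw [h2, ← one_add_mul]
      refine mul_le_mul_of_nonneg_right ?_ (weight_pos _ _ _ _).le
      rcases le_total (∑ u, sgn (ρ u) - m * n) 0 with h3 | h3
      · rw [hφ]
        simp only
        rw [max_eq_right h3, mul_zero, Real.exp_zero]
        linarith [Real.exp_pos (β * t * (∑ u, sgn (ρ u) - m * n))]
      · rw [hφ]
        simp only
        rw [max_eq_left h3]
        linarith
    have h4 : Real.exp (-(β * t * m * n)) * finZ β B (h + t) ≤ Real.exp θ * finZ β B h := by
      have h5 := Real.exp_le_exp.2 hB
      rw [Real.exp_log (finZ_pos _ _ _), Real.exp_add, Real.exp_add,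
        Real.exp_log (finZ_pos _ _ _)] at h5
      rw [Real.exp_neg, inv_mul_le_iff₀ (Real.exp_pos _)]
      linarith
    have h6 : ∑ ρ, Real.exp (φ ρ) * weight β B h ρ ≤ finZ β B h * (2 * Real.exp θ) := by
      have h7 : 1 ≤ Real.exp θ := Real.one_le_exp hθ
      have h8 := mul_le_mul_of_nonneg_right h7 (finZ_pos β B h).le
      linarith
    have h9 := Real.log_le_log hS h6
    rwa [Real.log_mul (finZ_pos _ _ _).ne' (by positivity), Real.log_mul two_ne_zero
      (Real.exp_ne_zero _), Real.log_exp, ← add_assoc] at h9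
  rw [hratio]
  have hmul := mul_le_mul_of_nonneg_left htile (Nat.cast_nonneg (α := ℝ) (Fintype.card ι))
  linarith

/-- Tile-wise constant quadratic forms in terms of the deviations of the tile averages. -/
lemma sq_mul_sum_sub_le {m Γ : ℝ} (hm0 : 0 ≤ m) (hm1 : m ≤ 1) (ψ : ι → ι → ℝ)
    (hψ : ∀ a b, 0 ≤ ψ a b) (hsymm : ∀ a b, ψ a b = ψ b a) (hΓ : ∀ a, ∑ b, ψ a b ≤ Γ)
    (x : ι → ℝ) (hx : ∀ a, |x a| ≤ 1) :
    m ^ 2 * ∑ a, ∑ b, ψ a b - 2 * Γ * ∑ a, |x a - m| ≤ ∑ a, ∑ b, ψ a b * (x a * x b) := by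
  -- This rests on `x a * x b - m ^ 2 = x a * (x b - m) + m * (x a - m)`.
  have hpt : ∀ a b, ψ a b * m ^ 2 - ψ a b * |x a - m| - ψ a b * |x b - m| ≤
      ψ a b * (x a * x b) := by
    intro a b
    rw [← mul_sub, ← mul_sub]
    refine mul_le_mul_of_nonneg_left ?_ (hψ a b)
    have h1 : -|x b - m| ≤ x a * (x b - m) := by
      refine (neg_le_neg ?_).trans (neg_abs_le _)
      rw [abs_mul]
      exact mul_le_of_le_one_left (abs_nonneg _) (hx a)
    have h2 : -|x a - m| ≤ m * (x a - m) := by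
      refine (neg_le_neg ?_).trans (neg_abs_le _)
      rw [abs_mul, abs_of_nonneg hm0]
      exact mul_le_of_le_one_left (abs_nonneg _) hm1
    nlinarith
  have hsum := Finset.sum_le_sum fun a (_ : a ∈ Finset.univ) =>
    Finset.sum_le_sum fun b (_ : b ∈ Finset.univ) => hpt a b
  refine le_trans ?_ hsum
  simp only [Finset.sum_sub_distrib, ← Finset.sum_mul]
  have h1 : ∑ a, (∑ b, ψ a b) * |x a - m| ≤ Γ * ∑ a, |x a - m| := by
    rw [Finset.mul_sum]
    exact Finset.sum_le_sum fun a _ => mul_le_mul_of_nonneg_right (hΓ a) (abs_nonneg _)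
  have h2 : ∑ a, ∑ b, ψ a b * |x b - m| = ∑ a, (∑ b, ψ a b) * |x a - m| := by
    rw [Finset.sum_comm]
    refine Finset.sum_congr rfl fun b _ => ?_
    rw [← Finset.sum_mul]
    congr 1
    exact Finset.sum_congr rfl fun a _ => hsymm a b
  rw [h2]
  linarith

lemma sum_tile_mul_sgn (ψ : ι → ι → ℝ) (τ : ι × κ → ℤˣ) :
    ∑ p : ι × κ, ∑ q : ι × κ, ψ p.1 q.1 * (sgn (τ p) * sgn (τ q)) =
      ∑ a, ∑ b, ψ a b * (tileSpin τ a * tileSpin τ b) := by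
  simp only [Fintype.sum_prod_type]
  refine Finset.sum_congr rfl fun a _ => ?_
  rw [Finset.sum_comm]
  refine Finset.sum_congr rfl fun b _ => ?_
  rw [tileSpin, tileSpin, Finset.sum_mul_sum, Finset.mul_sum]
  exact Finset.sum_congr rfl fun u _ => (Finset.mul_sum _ _ _).symm

end Concentration

/-! ### Tile concentration at small field and discretization of the kernel -/

section Tiling

variable {d : ℕ}

lemma tendsto_card_box_atTop (hd : 0 < d) :
    Tendsto (fun R : ℕ => ((box d R).card : ℝ)) atTop atTop := by
  simp only [card_box]
  refine (tendsto_pow_atTop hd.ne').comp ?_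
  exact tendsto_atTop_add_const_right _ _
    (tendsto_natCast_atTop_atTop.const_mul_atTop (by norm_num))

lemma tendsto_tile_side (R : ℕ) : Tendsto (fun k : ℕ => (2 * R + 1) * k + R) atTop atTop :=
  tendsto_atTop_mono (fun k => show k ≤ _ by nlinarith [Nat.zero_le (R * k)])
    tendsto_id

/-- If `β m` is the right derivative of the pressure at zero field, then in large volumes with a
small positive field the magnetization of most tiles is close to `m`. The size of the tiles does
not depend on the field. -/
lemma exists_tile_concentration (hd : 0 < d) {β m ε : ℝ} (hβ : 0 < β) (hε : 0 < ε)
    {c : Site d → ℝ} (hc : Summable fun y => |c y|)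
    (hlow : ∀ h, 0 < h → pressure β c 0 + β * m * h ≤ pressure β c h)
    (hup : ∃ t, 0 < t ∧ pressure β c t ≤ pressure β c 0 + β * t * (m + ε)) :
    ∃ R : ℕ, ∃ h₀ : ℝ, 0 < h₀ ∧ ∀ h, 0 < h → h ≤ h₀ → ∀ᶠ k in atTop,
      ∑ a, gibbs β (coupling c (tilePos k R)) h
        (fun τ => |tileSpin τ a / (box d R).card - m|) ≤ (box d k).card * (11 * ε) := by
  obtain ⟨t, ht, hpt⟩ := hup
  have hδ : 0 < ε * β * t := by positivity
  have ev1 := (tendsto_boxPressure hβ.le hc t).eventually_lt_const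
    (by linarith : pressure β c t < pressure β c t + ε * β * t / 2)
  have ev2 := (tendsto_boxPressure hβ.le hc 0).eventually_const_lt
    (by linarith : pressure β c 0 - ε * β * t / 2 < pressure β c 0)
  have ev3 := ((tendsto_boundaryTotal_box hc).const_mul β).eventually_lt_const
    (by rw [mul_zero]; exact hδ : β * 0 < ε * β * t)
  have ev4 := ((tendsto_const_nhds (x := Real.log 2)).div_atTop
    (tendsto_card_box_atTop hd)).eventually_lt_const hδ
  obtain ⟨R, h1, h2, h3, h4⟩ := (ev1.and (ev2.and (ev3.and ev4))).exists
  have hn := card_box_pos d R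
  have hcardR : (Fintype.card (box d R) : ℝ) = (box d R).card := by rw [Fintype.card_coe]
  -- `R` was fixed using the fields `0` and `t` only. For `h ≤ ε t / 2` the Lipschitz bound in the
  -- field transfers the estimates to `h` and `h + t`.
  refine ⟨R, ε * t / 2, by positivity, fun h hh hle => ?_⟩
  have ev5 := (((tendsto_boxPressure hβ.le hc h).sub (tendsto_boxPressure hβ.le hc 0)).comp
    (tendsto_tile_side R)).eventually_const_lt
    (by have := hlow h hh
        have h5 : 0 < β * h * ε := by positivity
        linarith : β * h * (m - ε) < pressure β c h - pressure β c 0)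
  filter_upwards [ev5] with k hk
  have hK := card_box_pos d k
  have hcardK : (Fintype.card (box d k) : ℝ) = (box d k).card := by rw [Fintype.card_coe]
  rw [Function.comp_apply, boxPressure, boxPressure, ← sub_div, card_tiles,
    lt_div_iff₀ (mul_pos hK hn), ← logZ_tiles, ← logZ_tiles] at hk
  set n : ℝ := ((box d R).card : ℝ)
  set K : ℝ := ((box d k).card : ℝ)
  set A := coupling c (tilePos (d := d) k R)
  -- The supporting line at `h`, evaluated at field 0, bounds the mean magnetization below by the
  -- slope of the pressure between 0 and `h`.
  have hmean : K * n * (m - ε) ≤ ∑ a, gibbs β A h (fun τ => tileSpin τ a) := by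
    have h5 := field_mul_gibbs_le β A h 0
    have h6 : gibbs β A h (fun τ => ∑ p, sgn (τ p)) = ∑ a, gibbs β A h (fun τ => tileSpin τ a) := by
      rw [← gibbs_sum]
      simp only [sum_tileSpin]
    rw [h6] at h5
    have h7 : β * h * (K * n * (m - ε)) ≤
        β * h * ∑ a, gibbs β A h (fun τ => tileSpin τ a) := by linarith
    exact le_of_mul_le_mul_left h7 (by positivity)
  have hR : boxPressure β c (h + t) R ≤ boxPressure β c h R + (β * t * m + 3 * (ε * β * t)) := by
    have h5 := (abs_le.1 (abs_boxPressure_field_sub_le hβ.le c (h + t) t R)).2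
    have h6 := (abs_le.1 (abs_boxPressure_field_sub_le hβ.le c h 0 R)).1
    rw [add_sub_cancel_right, abs_of_pos hh] at h5
    rw [sub_zero, abs_of_pos hh] at h6
    have h7 : β * h ≤ β * (ε * t / 2) := mul_le_mul_of_nonneg_left hle hβ.le
    linarith
  have hθ : logZ β c (h + t) (box d R) ≤
      logZ β c h (box d R) + β * t * m * Fintype.card (box d R) + n * (3 * (ε * β * t)) := by
    rw [boxPressure, boxPressure, div_add' _ _ _ hn.ne', div_le_div_iff_of_pos_right hn] at hR
    rw [hcardR]
    linarith
  have hpos := sum_gibbs_posPart_le hβ (by positivity) A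
    (coupling c (fun i : box d R => (i : Site d)))
    (sum_abs_coupling_sub_tileCoupling_le hc k R) hθ
  simp only [hcardR, hcardK] at hpos
  set P := ∑ a, gibbs β A h (fun τ => max (tileSpin τ a - m * n) 0)
  -- One `ε` from the interaction between tiles, one from `log 2`, three from the pressure
  -- increment.
  have hP : P ≤ 5 * ε * (K * n) := by
    rw [← mul_div_assoc, div_lt_iff₀ hn] at h3
    rw [div_lt_iff₀ hn] at h4
    have h8 := mul_le_mul_of_nonneg_left h3.le hK.le
    have h9 := mul_le_mul_of_nonneg_left h4.le hK.le
    have h10 : β * t * P ≤ β * t * (5 * ε * (K * n)) := by linarith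
    exact le_of_mul_le_mul_left h10 (by positivity)
  -- With `|x| = 2 max(x, 0) - x`, the upper deviations and the mean suffice: `2 * 5 ε + ε = 11 ε`.
  have habs : ∀ (a : box d k) (τ : box d k × box d R → ℤˣ), |tileSpin τ a / n - m| =
      (1 / n) * (2 * max (tileSpin τ a - m * n) 0 - tileSpin τ a + m * n) := by
    intro a τ
    have e : tileSpin τ a / n - m = (1 / n) * (tileSpin τ a - m * n) := by field_simp
    rw [e, abs_mul, abs_of_pos (by positivity : 0 < 1 / n)]
    congr 1
    rcases le_total (tileSpin τ a - m * n) 0 with h5 | h5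
    · rw [max_eq_right h5, abs_of_nonpos h5]; ring
    · rw [max_eq_left h5, abs_of_nonneg h5]; ring
  simp only [habs, gibbs_const_mul, gibbs_add, gibbs_sub, gibbs_const, ← Finset.mul_sum,
    Finset.sum_add_distrib, Finset.sum_sub_distrib, Finset.sum_const, nsmul_eq_mul,
    Finset.card_univ, hcardK]
  rw [one_div_mul_eq_div, div_le_iff₀ hn]
  linarith

/-- Bound for the change of `cutKernel` under displacements in a box. -/
def smoothConst (d : ℕ) (s : ℝ) (R : ℕ) : ℝ :=
  ∑ z ∈ box d (2 * R), (s + 1) * eucNorm z * (2 * ∑' y : Site d, powKernel s y)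

lemma smoothConst_nonneg {s : ℝ} (hs : 0 ≤ s) (R : ℕ) : 0 ≤ smoothConst d s R :=
  Finset.sum_nonneg fun z _ => mul_nonneg (mul_nonneg (by linarith) (eucNorm_nonneg z))
    (mul_nonneg zero_le_two (tsum_nonneg (powKernel_nonneg s)))

/-- `cutKernel` evaluated at the centers of the tiles. -/
def tileCut (s : ℝ) (j : Fin d) (L R k : ℕ) (a b : box d k) : ℝ :=
  cutKernel s j L ((2 * R + 1 : ℤ) • ((a : Site d) - b))

lemma tileCut_nonneg (s : ℝ) (j : Fin d) (L R k : ℕ) (a b : box d k) : 0 ≤ tileCut s j L R k a b :=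
  cutKernel_nonneg _ _ _ _

lemma cutKernel_neg (s : ℝ) (j : Fin d) (L : ℕ) (y : Site d) :
    cutKernel s j L (-y) = cutKernel s j L y := by
  simp [cutKernel, powKernel_neg, truncDisp]

lemma tileCut_symm (s : ℝ) (j : Fin d) (L R k : ℕ) (a b : box d k) :
    tileCut s j L R k a b = tileCut s j L R k b a := by
  rw [tileCut, tileCut, ← cutKernel_neg, ← smul_neg, neg_sub]

lemma sum_abs_cutKernel_sub_tileCut_le {s : ℝ} (hs : (d : ℝ) < s) (hs1 : 1 ≤ s) (j : Fin d)
    (L R k : ℕ) (p : box d k × box d R) :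
    ∑ q, |cutKernel s j L (tilePos k R p - tilePos k R q) - tileCut s j L R k p.1 q.1| ≤
      smoothConst d s R := by
  set κ := ∑' y : Site d, powKernel s y
  -- The shift to the tile centers depends on `q`; summing over all shifts in the box of half-side
  -- `2 R` removes this dependence, so that the sum over `q` can be taken for each fixed `z`.
  have hpt : ∀ q : box d k × box d R,
      |cutKernel s j L (tilePos k R p - tilePos k R q) - tileCut s j L R k p.1 q.1| ≤
      ∑ z ∈ box d (2 * R), (s + 1) * eucNorm z * (powKernel s (tilePos k R p - tilePos k R q) +
        powKernel s (tilePos k R p - tilePos k R q + z)) := by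
    intro q
    have hz : (q.2 : Site d) - p.2 ∈ box d (2 * R) := by
      refine mem_box.2 fun i => ?_
      have h1 := abs_le.1 (mem_box.1 p.2.2 i)
      have h2 := abs_le.1 (mem_box.1 q.2.2 i)
      rw [Pi.sub_apply, abs_le]
      push_cast
      constructor <;> linarith
    have e : (2 * R + 1 : ℤ) • ((p.1 : Site d) - q.1) =
        tilePos k R p - tilePos k R q + ((q.2 : Site d) - p.2) := by
      rw [tilePos, tilePos, smul_sub]
      abel
    rw [tileCut, e, abs_sub_comm]
    refine (abs_cutKernel_add_sub_le hs1 j L _ _).trans ?_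
    exact Finset.single_le_sum (f := fun z => (s + 1) * eucNorm z *
      (powKernel s (tilePos k R p - tilePos k R q) +
        powKernel s (tilePos k R p - tilePos k R q + z)))
      (fun z _ => mul_nonneg (mul_nonneg (by linarith) (eucNorm_nonneg z))
        (add_nonneg (powKernel_nonneg s _) (powKernel_nonneg s _))) hz
  refine (Finset.sum_le_sum fun q _ => hpt q).trans ?_
  rw [Finset.sum_comm]
  refine Finset.sum_le_sum fun z _ => ?_
  rw [← Finset.mul_sum, Finset.sum_add_distrib, two_mul]
  refine mul_le_mul_of_nonneg_left (add_le_add ?_ ?_)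
    (mul_nonneg (by linarith) (eucNorm_nonneg z))
  · exact sum_sub_le_tsum (powKernel_nonneg s) (summable_powKernel hs) (tilePos_injective k R) _
  · exact sum_comp_le_tsum (powKernel_nonneg s) (summable_powKernel hs)
      (f := fun q => tilePos k R p - tilePos k R q + z) fun _ _ h =>
        tilePos_injective k R (sub_right_injective (add_left_injective z h))

lemma pairTotal_box_tiles (F : Site d → ℝ) (k R : ℕ) :
    pairTotal F (box d ((2 * R + 1) * k + R)) =
      ∑ p : box d k × box d R, ∑ q : box d k × box d R, F (tilePos k R p - tilePos k R q) := by
  rw [pairTotal, ← (tileEquiv d k R).sum_comp]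
  refine Finset.sum_congr rfl fun p _ => ?_
  rw [← (tileEquiv d k R).sum_comp]
  rfl

lemma sum_tile_fst (ψ : box d k → box d k → ℝ) (R : ℕ) (a : box d k) :
    ∑ q : box d k × box d R, ψ a q.1 = (box d R).card * ∑ b, ψ a b := by
  rw [Fintype.sum_prod_type, Finset.mul_sum]
  simp

end Tiling

/-! ### The contradiction and the main theorem -/

/-- The right derivative of the pressure at zero field is not positive. -/
lemma not_magnetized {d : ℕ} {J s β m : ℝ} (hs : ((d + 1 : ℕ) : ℝ) < s)
    (hs' : s ≤ ((d + 1 : ℕ) : ℝ) + 1) (hβ : 0 < β) (hm : 0 < m) (hm1 : m ≤ 1)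
    (hlow : ∀ h, 0 < h → pressure β (fullKernel J s : Site (d + 1) → ℝ) 0 + β * m * h ≤
      pressure β (fullKernel J s : Site (d + 1) → ℝ) h)
    (hup : ∀ ε, 0 < ε → ∃ t, 0 < t ∧ pressure β (fullKernel J s : Site (d + 1) → ℝ) t ≤
      pressure β (fullKernel J s : Site (d + 1) → ℝ) 0 + β * t * (m + ε)) : False := by
  have hs1 : 1 ≤ s := by
    push_cast at hs
    linarith [Nat.cast_nonneg (α := ℝ) d]
  -- With `ε = m ^ 2 / 44` the deviation per tile averages at most `m ^ 2 / 4`, so the error `2 (G +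
  -- C) m ^ 2 / 4` takes only half of the main term `m ^ 2 G`.
  obtain ⟨R, h₀, hh₀, hconc⟩ := exists_tile_concentration (Nat.succ_pos d) hβ
    (by positivity : 0 < m ^ 2 / 44) (summable_abs_fullKernel J hs) hlow (hup _ (by positivity))
  set C := smoothConst (d + 1) s R
  have hC : 0 ≤ C := smoothConst_nonneg (by linarith) R
  set N₁ := |J| * ∑' y : Site (d + 1), nearKernel y
  -- The remaining half, `m ^ 2 G / 2`, must exceed all errors of order one per site. These depend
  -- on `R` but not on `L`, since `C` does not. The last `+ 1` makes the contradiction strict.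
  obtain ⟨L, hL⟩ := exists_le_tsum_cutKernel hs hs'
    ((1 + N₁ + m ^ 2 + 2 * m ^ 2 * C + C + 1) / (m ^ 2 / 2))
  rw [div_le_iff₀ (by positivity)] at hL
  set j : Fin (d + 1) := 0
  set G := ∑' y, cutKernel s j L y
  have hsum := summable_cutKernel hs j L
  obtain ⟨h, hh, hhh₀, hhL⟩ : ∃ h : ℝ, 0 < h ∧ h ≤ h₀ ∧ h * L ≤ 1 := by
    refine ⟨min h₀ (1 / (L + 1)), lt_min hh₀ (by positivity), min_le_left _ _, ?_⟩
    have h1 : min h₀ (1 / ((L : ℝ) + 1)) * L ≤ 1 / (L + 1) * L :=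
      mul_le_mul_of_nonneg_right (min_le_right _ _) (Nat.cast_nonneg L)
    refine h1.trans ?_
    rw [one_div_mul_eq_div, div_le_one (by positivity)]
    linarith
  have ev := ((tendsto_pairTotal_box (cutKernel_nonneg s j L) hsum).comp
    (tendsto_tile_side R)).eventually_const_lt (by linarith : G - 1 < G)
  obtain ⟨k, hk1, hk2⟩ := ((hconc h hh hhh₀).and ev).exists
  have hn := card_box_pos (d + 1) R
  have hK := card_box_pos (d + 1) k
  rw [Function.comp_apply, card_tiles, lt_div_iff₀ (mul_pos hK hn), pairTotal_box_tiles] at hk2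
  set n : ℝ := ((box (d + 1) R).card : ℝ)
  set K : ℝ := ((box (d + 1) k).card : ℝ)
  set f := tilePos (d := d + 1) k R
  have hf : Function.Injective f := tilePos_injective k R
  set A := coupling (fullKernel J s) f
  have hcard : (Fintype.card (box (d + 1) k × box (d + 1) R) : ℝ) = K * n := by
    rw [Fintype.card_prod, Fintype.card_coe, Fintype.card_coe, Nat.cast_mul]
  set ψ := tileCut s j L R k
  set E : (box (d + 1) k × box (d + 1) R) → (box (d + 1) k × box (d + 1) R) → ℝ :=
    fun p q => gibbs β A h (fun τ => sgn (τ p) * sgn (τ q))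
  have hE : ∀ p q, |E p q| ≤ 1 := fun p q => abs_gibbs_le fun τ => by
    rw [abs_mul, abs_sgn, abs_sgn, one_mul]
  have hcut : ∑ p, ∑ q, cutKernel s j L (f p - f q) * E p q ≤ (h * L + N₁) * (K * n) := by
    rw [← hcard]
    exact sum_cutKernel_gibbs_le hβ hh.le hf j L
  have hosc : ∑ p, ∑ q, |cutKernel s j L (f p - f q) - ψ p.1 q.1| ≤ K * n * C := by
    rw [← hcard, ← nsmul_eq_mul, ← Finset.card_univ]
    exact Finset.sum_le_card_nsmul _ _ _ fun p _ =>
      sum_abs_cutKernel_sub_tileCut_le hs hs1 j L R k p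
  have hsmooth : ∑ p, ∑ q, ψ p.1 q.1 * E p q ≤
      ∑ p, ∑ q, cutKernel s j L (f p - f q) * E p q + K * n * C := by
    refine le_trans ?_ (add_le_add_right hosc _)
    simp only [← Finset.sum_add_distrib]
    refine Finset.sum_le_sum fun p _ => Finset.sum_le_sum fun q _ => ?_
    have h1 : (ψ p.1 q.1 - cutKernel s j L (f p - f q)) * E p q ≤
        |cutKernel s j L (f p - f q) - ψ p.1 q.1| := by
      refine (le_abs_self _).trans ?_
      rw [abs_mul, abs_sub_comm]
      exact mul_le_of_le_one_right (abs_nonneg _) (hE p q)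
    linarith
  have htotal : (G - 1) * (K * n) - K * n * C ≤ n * (n * ∑ a, ∑ b, ψ a b) := by
    have h1 : ∑ p : box (d + 1) k × box (d + 1) R, ∑ q : box (d + 1) k × box (d + 1) R,
        ψ p.1 q.1 = n * (n * ∑ a, ∑ b, ψ a b) := by
      simp only [sum_tile_fst ψ R]
      rw [Fintype.sum_prod_type]
      simp [← Finset.mul_sum, n]
    rw [← h1]
    have h2 : ∑ p, ∑ q, cutKernel s j L (f p - f q) ≤ ∑ p : box (d + 1) k × box (d + 1) R,
        ∑ q : box (d + 1) k × box (d + 1) R, ψ p.1 q.1 + K * n * C := by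
      refine le_trans ?_ (add_le_add_right hosc _)
      simp only [← Finset.sum_add_distrib]
      refine Finset.sum_le_sum fun p _ => Finset.sum_le_sum fun q _ => ?_
      linarith [le_abs_self (cutKernel s j L (f p - f q) - ψ p.1 q.1)]
    linarith
  -- Compare with the row of the true kernel at the central site of the tile `a`.
  have hrow : ∀ a, ∑ b, ψ a b ≤ (G + C) / n := by
    intro a
    have h0 : (0 : Site (d + 1)) ∈ box (d + 1) R := mem_box.2 fun i => by simp
    rw [le_div_iff₀ hn, mul_comm, ← sum_tile_fst ψ R a]
    have h1 := sum_abs_cutKernel_sub_tileCut_le hs hs1 j L R k (a, ⟨0, h0⟩)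
    have h2 := sum_sub_le_tsum (cutKernel_nonneg s j L) hsum hf (f (a, ⟨0, h0⟩))
    refine le_trans ?_ (add_le_add h2 h1)
    rw [← Finset.sum_add_distrib]
    refine Finset.sum_le_sum fun q _ => ?_
    linarith [neg_abs_le (cutKernel s j L (f (a, ⟨0, h0⟩) - f q) - ψ a q.1)]
  set S := ∑ a, gibbs β A h (fun τ => |tileSpin τ a / n - m|)
  have hquad : n * (n * (m ^ 2 * ∑ a, ∑ b, ψ a b - 2 * ((G + C) / n) * S)) ≤
      ∑ p, ∑ q, ψ p.1 q.1 * E p q := by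
    have h1 : ∑ p, ∑ q, ψ p.1 q.1 * E p q = gibbs β A h
        (fun τ => ∑ a, ∑ b, ψ a b * (tileSpin τ a * tileSpin τ b)) := by
      simp only [← sum_tile_mul_sgn, gibbs_sum, gibbs_const_mul, E]
    have h2 : n * (n * (m ^ 2 * ∑ a, ∑ b, ψ a b - 2 * ((G + C) / n) * S)) = gibbs β A h
        (fun τ => n * (n * (m ^ 2 * ∑ a, ∑ b, ψ a b -
          2 * ((G + C) / n) * ∑ a, |tileSpin τ a / n - m|))) := by
      simp only [gibbs_const_mul, gibbs_sub, gibbs_const, gibbs_sum, S]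
    rw [h1, h2]
    refine gibbs_mono fun τ => ?_
    have h3 := sq_mul_sum_sub_le hm.le hm1 ψ (tileCut_nonneg s j L R k) (tileCut_symm s j L R k)
      hrow (fun a => tileSpin τ a / n) fun a => by
        rw [abs_div, abs_of_pos hn, div_le_one hn]
        refine (abs_sum_sgn_le _).trans_eq ?_
        rw [Fintype.card_coe]
    have h4 : ∑ a, ∑ b, ψ a b * (tileSpin τ a * tileSpin τ b) =
        n * (n * ∑ a, ∑ b, ψ a b * (tileSpin τ a / n * (tileSpin τ b / n))) := by
      simp only [Finset.mul_sum]
      refine Finset.sum_congr rfl fun a _ => Finset.sum_congr rfl fun b _ => ?_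
      field_simp
    rw [h4]
    exact mul_le_mul_of_nonneg_left (mul_le_mul_of_nonneg_left h3 hn.le) hn.le
  have hGC : 0 ≤ G + C := add_nonneg (tsum_nonneg (cutKernel_nonneg s j L)) hC
  have hS : 2 * (G + C) * n * S ≤ 2 * (G + C) * n * (K * (11 * (m ^ 2 / 44))) :=
    mul_le_mul_of_nonneg_left hk1 (by positivity)
  have e : n * (n * (m ^ 2 * ∑ a, ∑ b, ψ a b - 2 * ((G + C) / n) * S)) =
      m ^ 2 * (n * (n * ∑ a, ∑ b, ψ a b)) - 2 * (G + C) * n * S := by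
    field_simp
  have ht := mul_le_mul_of_nonneg_left htotal (sq_nonneg m)
  have hT : 0 < K * n := mul_pos hK hn
  have hhT := mul_le_mul_of_nonneg_right hhL hT.le
  have hLT := mul_le_mul_of_nonneg_right hL hT.le
  have hCT : 0 ≤ m ^ 2 * C * (K * n) := by positivity
  linarith

end LongRangeIsing

end

/-- The free energy is well defined (the limit exists for every boundary condition and does not
depend on it), its right derivative at zero field exists, and the spontaneous magnetization is
zero. -/
theorem theorem1 (d : ℕ) (hd : 1 ≤ d) (J s β : ℝ) (hs : (d : ℝ) < s) (hs' : s ≤ (d : ℝ) + 1)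
    (hβ : 0 < β) :
    (∀ (h : ℝ) (η : Config d),
      Tendsto (boxFreeEnergy J s β h η) atTop (𝓝 (freeEnergy d J s β h))) ∧
    DifferentiableWithinAt ℝ (fun h => freeEnergy d J s β h) (Set.Ici 0) 0 ∧
    spontaneousMagnetization d J s β = 0 := by
  refine ⟨fun h η => ?_, ?_⟩
  · rw [freeEnergy_eq J hs hβ]
    exact tendsto_boxFreeEnergy J hs hβ h η
  have hf : (fun h => freeEnergy d J s β h) =
      fun h => -(1 / β) * pressure β (fullKernel J s : Site d → ℝ) h :=
    funext fun h => freeEnergy_eq J hs hβ h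
  set P := pressure β (fullKernel J s : Site d → ℝ) with hP
  have hc := summable_abs_fullKernel (d := d) J hs
  have hconv : ConvexOn ℝ Set.univ P := convexOn_pressure hβ.le hc
  have hderiv : HasDerivWithinAt P (derivWithin P (Set.Ioi 0) 0) (Set.Ioi 0) 0 :=
    hconv.hasDerivWithinAt_rightDeriv_of_mem_interior (by simp)
  set D := derivWithin P (Set.Ioi 0) 0
  have hslope : Tendsto (slope P 0) (𝓝[>] 0) (𝓝 D) :=
    (hasDerivWithinAt_iff_tendsto_slope' (lt_irrefl 0)).1 hderiv
  have hle : ∀ h, 0 < h → D ≤ slope P 0 h := fun h hh =>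
    hconv.rightDeriv_le_slope_of_mem_interior (by simp) (Set.mem_univ h) hh
  have hmin : ∀ h, P 0 ≤ P h := by
    intro h
    have h1 := hconv.2 (Set.mem_univ h) (Set.mem_univ (-h)) (by norm_num : (0 : ℝ) ≤ 1 / 2)
      (by norm_num : (0 : ℝ) ≤ 1 / 2) (by norm_num)
    have h2 : P (-h) = P h := pressure_neg _ h
    simp only [smul_eq_mul, h2] at h1
    have h3 : (1 / 2 : ℝ) * h + 1 / 2 * -h = 0 := by ring
    rw [h3] at h1
    linarith
  -- An even convex function has its minimum at 0, hence nonnegative slopes to the right.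
  have hD0 : 0 ≤ D := ge_of_tendsto hslope (by
    filter_upwards [self_mem_nhdsWithin] with h hh
    rw [slope_def_field]
    exact div_nonneg (sub_nonneg.2 (hmin h)) (by simpa using (le_of_lt hh)))
  have hDβ : D ≤ β := by
    have h1 := hle 1 one_pos
    have h2 := (abs_le.1 (abs_pressure_sub_le hβ.le hc 1 0)).2
    rw [slope_def_field] at h1
    simp only [sub_zero, abs_one, mul_one, div_one] at h1 h2
    exact h1.trans h2
  have hD : D = 0 := by
    by_contra hne
    have hDpos : 0 < D := lt_of_le_of_ne hD0 (Ne.symm hne)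
    obtain ⟨e, rfl⟩ : ∃ e, d = e + 1 := ⟨d - 1, by omega⟩
    have hmul : β * (D / β) = D := mul_div_cancel₀ D hβ.ne'
    -- The magnetization is `m = D / β`; the Lipschitz constant `β` of the pressure in the field
    -- gives `m ≤ 1`.
    refine not_magnetized (J := J) hs hs' hβ (div_pos hDpos hβ) ((div_le_one hβ).2 hDβ)
      (fun h hh => ?_) (fun ε hε => ?_)
    · have h1 := hle h hh
      rw [slope_def_field, sub_zero, le_div_iff₀ hh] at h1
      rw [hmul]
      linarith
    · have h1 := hslope.eventually_lt_const
        (by have : 0 < β * ε := by positivity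
            linarith : D < D + β * ε)
      obtain ⟨t, ht, ht0⟩ := (h1.and self_mem_nhdsWithin).exists
      refine ⟨t, ht0, ?_⟩
      rw [slope_def_field, sub_zero, div_lt_iff₀ ht0] at ht
      have h2 : β * t * (D / β + ε) = (D + β * ε) * t := by
        rw [mul_add, mul_right_comm, hmul]
        ring
      rw [h2]
      linarith
  rw [hD] at hderiv
  have hfin : HasDerivWithinAt (fun h => freeEnergy d J s β h) 0 (Set.Ici 0) 0 := by
    rw [hf]
    simpa using (hasDerivWithinAt_Ioi_iff_Ici.1 hderiv).const_mul (-(1 / β))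
  refine ⟨hfin.differentiableWithinAt, ?_⟩
  rw [spontaneousMagnetization, hfin.derivWithin (uniqueDiffWithinAt_Ici 0), neg_zero]
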